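/- For $N\ge 1$ and $x\in\mathbb C\setminus[0,\infty)$ let $$W_1(x)=\frac1{\mathcal Z}\int_{[0,\infty)^N}\Bigl(\sum_{i=1}^N\frac1{x-\lambda_i}\Bigr)e^{-N\sum_i\lambda_i}\prod_{i<j}(\lambda_i-\lambda_j)^2\,d\lambda_1\cdots d\lambda_N,\qquad \mathcal Z=\int_{[0,\infty)^N}e^{-N\sum_i\lambda_i}\prod_{i<j}(\lambda_i-\lambda_j)^2\,d\lambda_1\cdots d\lambda_N,$$ be the one-loop mean of the $N\times N$ Laguerre ensemble. For every $x\in\mathbb C\setminus[0,\infty)$ with $|x|>4$ it has an asymptotic expansion $W_1(x)\sim\sum_{g\ge0}N^{1-2g}W_1^{(g)}(x)$ as $N\to\infty$, that is, for each $G\ge0$, $$W_1(x)-\sum_{g=0}^{G}N^{1-2g}W_1^{(g)}(x)=O(N^{-1-2G}),$$ and there are numbers $C_n^{(g)}$ ($n,g\ge0$) such that, for all such $x$, $W_1^{(g)}(x)=\sum_{n\ge0}C_n^{(g)}x^{-1-2g-n}$ (a convergent series). Moreover, whenever these two expansions hold for all $x\in\mathbb C\setminus[0,\infty)$ with $|x|>R$,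 for some real $R$, the coefficients satisfy the three-term recursion $$(n+2g+1)\,C_n^{(g)}=(n+2g-2)(n+2g-1)^2\,C_n^{(g-1)}+2(2n+4g-1)\,C_{n-1}^{(g)},\qquad n>0,\ g>0,$$ and $$C_0^{(0)}=1,\qquad C_0^{(g)}=0\quad(g\ge1),\qquad C_1^{(g)}=\frac{2^g\,g!\,(2g-1)!!}{g+1}\quad(g\ge0),$$ where $(-1)!!=1$. -/

import Mathlib

open scoped Nat

noncomputable section

namespace Laguerre

/-- The unnormalised joint density `exp (-N ∑ λᵢ) Δ(λ)²` of the eigenvalues in the `N × N` Laguerre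
ensemble, where `Δ(λ) = ∏_{i<j} (λᵢ - λⱼ)`. -/
def weight (N : ℕ) (l : Fin N → ℝ) : ℝ :=
  Real.exp (-(N : ℝ) * ∑ i, l i) * (∏ i, ∏ j ∈ Finset.Ioi i, (l i - l j)) ^ 2

/-- The domain `[0, ∞)^N` of the eigenvalues. -/
def domain (N : ℕ) : Set (Fin N → ℝ) := {l | ∀ i, 0 ≤ l i}

/-- The normalising constant `Z`. -/
def partitionFunction (N : ℕ) : ℝ :=
  ∫ l in domain N, weight N l

/-- The one-loop mean `W₁(x) = ⟨tr (x - H)⁻¹⟩` at matrix size `N`. It is meant for `x` in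
`ℂ \ [0, ∞)`, where the integrand is a bounded function times the integrable weight. -/
def oneLoopMean (N : ℕ) (x : ℂ) : ℂ :=
  ((partitionFunction N : ℝ) : ℂ)⁻¹ *
    ∫ l in domain N, ((weight N l : ℝ) : ℂ) * ∑ i, (x - ((l i : ℝ) : ℂ))⁻¹

/-- The neighbourhood `|x| > R` of infinity in `ℂ`, with the half-line `[0, ∞)` removed. -/
def cutNhd (R : ℝ) : Set ℂ :=
  {x | R < ‖x‖ ∧ ∀ t : ℝ, 0 ≤ t → x ≠ (t : ℂ)}

/-- The functions `W g = W₁^{(g)}` are the terms of the genus (that is, `1/N`) expansion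
`W₁(x) ~ ∑_g N^{1-2g} W₁^{(g)}(x)`, an asymptotic expansion as `N → ∞`, for each `x` off the
half-line with `|x| > R`. -/
def IsGenusExpansion (R : ℝ) (W : ℕ → ℂ → ℂ) : Prop :=
  ∀ x ∈ cutNhd R, ∀ G : ℕ,
    Asymptotics.IsBigO Filter.atTop
      (fun N : ℕ => oneLoopMean N x -
        ∑ g ∈ Finset.range (G + 1), (N : ℂ) ^ (1 - 2 * (g : ℤ)) * W g x)
      (fun N : ℕ => (N : ℝ) ^ (-1 - 2 * (G : ℤ)))

/-- The numbers `C g n = C_n^{(g)}` are the coefficients in the convergent expansions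
`W₁^{(g)}(x) = ∑_{n ≥ 0} C_n^{(g)} x^{-1-2g-n}` for `x` off the half-line with `|x| > R`. -/
def IsCoefficients (R : ℝ) (W : ℕ → ℂ → ℂ) (C : ℕ → ℕ → ℂ) : Prop :=
  ∀ g : ℕ, ∀ x ∈ cutNhd R,
    HasSum (fun n : ℕ => C g n * x ^ (-1 - 2 * (g : ℤ) - (n : ℤ))) (W g x)

end Laguerre

end

/-!
By Andréief's identity, the mean of a linear statistic of the eigenvalues is its integral against
the one-point measure, with density `∑_{m < N} N L_m(Nt)² e^{-Nt}`. Integration by parts against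
`e⁻ᵗ`, applied to products of consecutive Laguerre polynomials, yields the Haagerup–Thorbjørnsen
recursion `(k + 3) m_{k+2} = 2 (2k + 3) m_{k+1} + N⁻² (k + 1)² k m_k` for the moments `N m_k` of
this measure. Hence `m_k = ∑_g c_{k,g} N^{-2g}`, where `c_{k,g}` satisfies the induced recursion and
`0 ≤ c_{k,g} ≤ 4ᵏ k^{3g} / g!`.

In the moment expansion `W₁(x) = N ∑_k m_k x^{-k-1}`, which is only formal because the measure is
not compactly supported, keep the terms with `k` up to about `√N`: for `|x| > 4` the error is
smaller than every power of `N⁻¹`, and since `k³ N⁻²` stays bounded the series in `g` may be cut off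
uniformly in `k`. This gives the genus expansion with `W₁^{(g)}(x) = ∑_k c_{k,g} x^{-k-1}`. The
terms with `k ≤ 2g` vanish for `g ≥ 1`, and substituting `k = n + 2g` turns the recursion for
`c_{k,g}` into the three-term recursion. Both expansions determine their coefficients, so the same
formulas hold for any `W₁^{(g)}` and `C_n^{(g)}` for which the expansions hold.
-/

section Determinants

open Matrix Polynomial

variable {ι R : Type*} [Fintype ι] [DecidableEq ι] [CommRing R]

lemma det_eval_of_natDegree_le {n : ℕ} (p : Fin n → R[X]) (hp : ∀ j, (p j).natDegree ≤ j)
    (v : Fin n → R) :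
    (of fun i j => (p j).eval (v i)).det = (∏ j, (p j).coeff j) * (vandermonde v).det := by
  rw [eval_matrixOfPolynomials_eq_vandermonde_mul_matrixOfPolynomials v p hp, det_mul, mul_comm,
    det_of_isUpperTriangular (matrixOfPolynomials_blockTriangular p hp)]
  rfl

lemma sum_det_updateRow_mul (M : Matrix ι ι R) (d : ι → R) :
    ∑ b, (M.updateRow b fun i => M b i * d i).det = M.det * ∑ i, d i := by
  have expand (b : ι) : (M.updateRow b fun i => M b i * d i).det =
      ∑ i, M.adjugate i b * M b i * d i := by
    rw [← cramer_transpose_apply, cramer_eq_adjugate_mulVec, ← adjugate_transpose]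
    simp only [mulVec, dotProduct, transpose_apply, mul_assoc]
  have diagonal (i : ι) : ∑ b, M.adjugate i b * M b i = M.det := by
    rw [← mul_apply, adjugate_mul, Matrix.smul_apply, one_apply_eq, smul_eq_mul, mul_one]
  simp only [expand]
  rw [Finset.sum_comm, Finset.mul_sum]
  simp only [← Finset.sum_mul, diagonal]

lemma det_mul_prod_eq_sum (M : Matrix ι ι R) (c : ι → R) :
    M.det * ∏ b, c b =
      ∑ σ : Equiv.Perm ι, (Equiv.Perm.sign σ : R) * ∏ b, M (σ b) b * c b := by
  simp only [det_apply', Finset.sum_mul, mul_assoc, Finset.prod_mul_distrib]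

lemma det_mul_det_eq_sum (M P : Matrix ι ι R) :
    M.det * P.det =
      ∑ τ : Equiv.Perm ι, (Equiv.Perm.sign τ : R) * (M.det * ∏ b, P (τ b) b) := by
  rw [det_apply' P, Finset.mul_sum]
  exact Finset.sum_congr rfl fun τ _ => mul_left_comm _ _ _

end Determinants

section Andreief

open MeasureTheory Matrix

variable {ι Ω 𝕜 : Type*} [Fintype ι] [DecidableEq ι] [MeasurableSpace Ω] {μ : Measure Ω}
  [SigmaFinite μ] [RCLike 𝕜] {u v : ι → Ω → 𝕜}

lemma integrable_det_mul_prod (h : ∀ a b, Integrable (fun t => u a t * v b t) μ) :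
    Integrable (fun l : ι → Ω => (of fun a b => u a (l b)).det * ∏ b, v b (l b))
      (Measure.pi fun _ => μ) := by
  simp only [det_mul_prod_eq_sum, of_apply]
  exact integrable_finsetSum _ fun σ _ =>
    (Integrable.fintype_prod fun b => h (σ b) b).const_mul _

lemma integral_det_mul_prod (h : ∀ a b, Integrable (fun t => u a t * v b t) μ) :
    ∫ l : ι → Ω, (of fun a b => u a (l b)).det * ∏ b, v b (l b) ∂(Measure.pi fun _ => μ) =
      (of fun a b => ∫ t, u a t * v b t ∂μ).det := by
  simp only [det_mul_prod_eq_sum, of_apply]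
  rw [integral_finsetSum _ fun σ _ =>
    (Integrable.fintype_prod fun b => h (σ b) b).const_mul _, det_apply']
  refine Finset.sum_congr rfl fun σ _ => ?_
  rw [integral_const_mul, integral_fintype_prod_eq_prod fun b t => u (σ b) t * v b t]
  rfl

lemma integrable_det_mul_det (h : ∀ a b, Integrable (fun t => u a t * v b t) μ) :
    Integrable (fun l : ι → Ω =>
      (of fun a b => u a (l b)).det * (of fun a b => v a (l b)).det)
      (Measure.pi fun _ => μ) := by
  simp only [det_mul_det_eq_sum, of_apply]
  exact integrable_finsetSum _ fun τ _ =>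
    (integrable_det_mul_prod fun a b => h a (τ b)).const_mul _

/-- Andréief's identity. -/
lemma integral_det_mul_det (h : ∀ a b, Integrable (fun t => u a t * v b t) μ) :
    ∫ l : ι → Ω, (of fun a b => u a (l b)).det * (of fun a b => v a (l b)).det
        ∂(Measure.pi fun _ => μ) =
      (Fintype.card ι).factorial * (of fun a b => ∫ t, u a t * v b t ∂μ).det := by
  have term (τ : Equiv.Perm ι) : (Equiv.Perm.sign τ : 𝕜) *
      ∫ l : ι → Ω, (of fun a b => u a (l b)).det * ∏ b, v (τ b) (l b) ∂(Measure.pi fun _ => μ) =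
      (of fun a b => ∫ t, u a t * v b t ∂μ).det := by
    rw [integral_det_mul_prod fun a b => h a (τ b)]
    have permuted := det_permute' τ (of fun a b => ∫ t, u a t * v b t ∂μ)
    have sign_sq : (Equiv.Perm.sign τ : 𝕜) * (Equiv.Perm.sign τ : 𝕜) = 1 := by
      rw [← Int.cast_mul, Int.units_coe_mul_self, Int.cast_one]
    calc _ = (Equiv.Perm.sign τ : 𝕜) * _ := congrArg _ permuted
      _ = _ := by rw [← mul_assoc, sign_sq, one_mul]
  simp only [det_mul_det_eq_sum, of_apply]
  rw [integral_finsetSum _ fun τ _ =>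
    (integrable_det_mul_prod fun a b => h a (τ b)).const_mul _]
  simp only [integral_const_mul, term]
  rw [Finset.sum_const, Finset.card_univ, Fintype.card_perm, nsmul_eq_mul]

lemma integral_det_mul_det_of_biorthonormal (h : ∀ a b, Integrable (fun t => u a t * v b t) μ)
    (hδ : ∀ a b, ∫ t, u a t * v b t ∂μ = if a = b then 1 else 0) :
    ∫ l : ι → Ω, (of fun a b => u a (l b)).det * (of fun a b => v a (l b)).det
        ∂(Measure.pi fun _ => μ) = (Fintype.card ι).factorial := by
  have gram : (of fun a b => ∫ t, u a t * v b t ∂μ) = 1 := by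
    ext a b
    rw [of_apply, hδ, one_apply]
  rw [integral_det_mul_det h, gram, det_one, mul_one]

/-- A linear statistic `∑ i, f (l i)` acts on `det v` by multiplying one function `v b` at a time
by `f`, so its mean is a sum of instances of Andréief's identity. -/
lemma integral_det_mul_det_mul_sum_of_biorthonormal
    (h : ∀ a b, Integrable (fun t => u a t * v b t) μ)
    (hδ : ∀ a b, ∫ t, u a t * v b t ∂μ = if a = b then 1 else 0) {f : Ω → 𝕜}
    (hf : ∀ a b, Integrable (fun t => u a t * (v b t * f t)) μ) :
    ∫ l : ι → Ω, (of fun a b => u a (l b)).det * (of fun a b => v a (l b)).det * ∑ i, f (l i)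
        ∂(Measure.pi fun _ => μ) =
      (Fintype.card ι).factorial * ∑ a, ∫ t, u a t * (v a t * f t) ∂μ := by
  let vf (c : ι) : ι → Ω → 𝕜 := Function.update v c fun t => v c t * f t
  have hvf (c a b : ι) : Integrable (fun t => u a t * vf c b t) μ := by
    rcases eq_or_ne b c with rfl | hb
    · simpa only [vf, Function.update_self] using hf a b
    · simpa only [vf, Function.update_of_ne hb] using h a b
  have expand (l : ι → Ω) :
      (of fun a b => u a (l b)).det * (of fun a b => v a (l b)).det * ∑ i, f (l i) =
        ∑ c, (of fun a b => u a (l b)).det * (of fun a b => vf c a (l b)).det := by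
    rw [mul_assoc, ← sum_det_updateRow_mul, Finset.mul_sum]
    refine Finset.sum_congr rfl fun c _ => congrArg ((of fun a b => u a (l b)).det * det ·) ?_
    ext a b
    rcases eq_or_ne a c with rfl | ha
    · simp only [updateRow_self, of_apply, vf, Function.update_self]
    · simp only [updateRow_ne ha, of_apply, vf, Function.update_of_ne ha]
  have gram (c : ι) : (of fun a b => ∫ t, u a t * vf c b t ∂μ).det =
      ∫ t, u c t * (v c t * f t) ∂μ := by
    have updated : (of fun a b => ∫ t, u a t * vf c b t ∂μ) =
        (1 : Matrix ι ι 𝕜).updateCol c fun a => ∫ t, u a t * (v c t * f t) ∂μ := by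
      ext a b
      rcases eq_or_ne b c with rfl | hb
      · simp only [updateCol_self, of_apply, vf, Function.update_self]
      · simp only [updateCol_ne hb, of_apply, vf, Function.update_of_ne hb, hδ, one_apply]
    rw [updated, ← cramer_apply, cramer_one]
    rfl
  simp only [expand]
  rw [integral_finsetSum _ fun c _ => integrable_det_mul_det (hvf c)]
  simp only [integral_det_mul_det (hvf _), gram, Finset.mul_sum]

end Andreief

section Series

variable {E : Type*} [NormedAddCommGroup E] [CompleteSpace E] {a : ℕ → E} {J : ℕ}

lemma summable_of_summable_pow_mul_norm (h : Summable fun k : ℕ => (k : ℝ) ^ J * ‖a k‖) :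
    Summable a := by
  refine (summable_nat_add_iff 1).1 (.of_norm_bounded ((summable_nat_add_iff 1).2 h) fun k => ?_)
  exact le_mul_of_one_le_left (norm_nonneg _) (one_le_pow₀ (by norm_cast; omega))

lemma pow_mul_norm_tsum_sub_sum_le (h : Summable fun k : ℕ => (k : ℝ) ^ J * ‖a k‖) (K : ℕ) :
    (K : ℝ) ^ J * ‖∑' k, a k - ∑ k ∈ Finset.range K, a k‖ ≤ ∑' k : ℕ, (k : ℝ) ^ J * ‖a k‖ := by
  have ha : Summable a := summable_of_summable_pow_mul_norm h
  rcases (pow_nonneg (Nat.cast_nonneg K) J : (0 : ℝ) ≤ (K : ℝ) ^ J).eq_or_lt with h0 | hK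
  · rw [← h0, zero_mul]
    exact tsum_nonneg fun k => by positivity
  have tail := (summable_nat_add_iff K).2 h
  rw [← ha.sum_add_tsum_nat_add K, add_sub_cancel_left, ← le_div_iff₀' hK,
    ← h.sum_add_tsum_nat_add K]
  calc ‖∑' k, a (k + K)‖
      ≤ ∑' k, ((k + K : ℕ) : ℝ) ^ J * ‖a (k + K)‖ / (K : ℝ) ^ J := by
        refine tsum_of_norm_bounded (tail.div_const _).hasSum fun k => ?_
        rw [le_div_iff₀' hK]
        gcongr
        omega
    _ = (∑' k, ((k + K : ℕ) : ℝ) ^ J * ‖a (k + K)‖) / (K : ℝ) ^ J := tsum_div_const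
    _ ≤ _ := by
        gcongr
        exact le_add_of_nonneg_left (Finset.sum_nonneg fun k _ => by positivity)

end Series

section ExponentialTails

variable {a : ℕ → ℝ} {s A y : ℝ}

lemma sub_sum_nonneg_of_hasSum (hs : HasSum a s) (ha : ∀ g, 0 ≤ a g) (j : ℕ) :
    0 ≤ s - ∑ g ∈ Finset.range j, a g :=
  sub_nonneg.2 (sum_le_hasSum _ (fun g _ => ha g) hs)

lemma sub_sum_le_of_le_pow_div_factorial (hs : HasSum a s) (hA : 0 ≤ A) (hy : 0 ≤ y)
    (ha : ∀ g, a g ≤ A * (y ^ g / g.factorial)) (j : ℕ) :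
    s - ∑ g ∈ Finset.range j, a g ≤ A * (y ^ j * Real.exp y) := by
  have hexp : HasSum (fun g => A * (y ^ j * (y ^ g / g.factorial))) (A * (y ^ j * Real.exp y)) := by
    rw [Real.exp_eq_exp_ℝ]
    exact ((NormedSpace.expSeries_div_hasSum_exp y).mul_left _).mul_left _
  refine hasSum_le (fun g => (ha (g + j)).trans ?_) ((hasSum_nat_add_iff' j).2 hs) hexp
  rw [pow_add, mul_comm (y ^ g), mul_div_assoc]
  gcongr
  exact Nat.le_add_right g j

end ExponentialTails

section PowerSeries

open Topology

variable {𝕜 : Type*} [NontriviallyNormedField 𝕜] [CompleteSpace 𝕜]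

lemma eq_zero_of_frequently_hasSum_zero {d : ℕ → 𝕜}
    (h : ∃ᶠ z in 𝓝[≠] (0 : 𝕜), HasSum (fun n => d n * z ^ n) 0) : d = 0 := by
  let p := FormalMultilinearSeries.ofScalars 𝕜 d
  have radius_pos : 0 < p.radius := by
    obtain ⟨z, hz, hz0⟩ := (h.and_eventually self_mem_nhdsWithin).exists
    have bound : (‖z‖₊ : ENNReal) ≤ p.radius := by
      refine p.le_radius_of_tendsto (l := 0) ?_
      simpa [p, FormalMultilinearSeries.ofScalars_norm] using hz.summable.tendsto_atTop_zero.norm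
    exact lt_of_lt_of_le (ENNReal.coe_pos.2 (nnnorm_pos.2 hz0)) bound
  have hp := p.hasFPowerSeriesOnBall radius_pos
  have frequently_zero : ∃ᶠ z in 𝓝[≠] (0 : 𝕜), p.sum z = 0 := h.mono fun z hz => by
    simpa [p, FormalMultilinearSeries.sum, mul_comm] using hz.tsum_eq
  have eventually_zero := hp.analyticAt.frequently_zero_iff_eventually_zero.1 frequently_zero
  have hp0 : p = 0 := HasFPowerSeriesAt.eq_zero (hp.hasFPowerSeriesAt.congr eventually_zero)
  ext n
  rw [← FormalMultilinearSeries.coeff_ofScalars (𝕜 := 𝕜) (p := d)]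
  exact congrArg (fun q => FormalMultilinearSeries.coeff q n) hp0

end PowerSeries

lemma zpow_one_sub_two_mul {F : Type*} [Field F] (a : F) (g : ℕ) :
    a ^ (1 - 2 * (g : ℤ)) = a * ((a ^ 2)⁻¹) ^ g := by
  rcases eq_or_ne a 0 with rfl | ha
  · rw [zero_mul, zero_zpow _ (by omega)]
  · rw [zpow_sub₀ ha, zpow_one, zpow_mul, zpow_natCast, inv_pow, div_eq_mul_inv, zpow_ofNat]

section StieltjesTransform

open MeasureTheory

lemma inv_sub_sub_sum_geometric {F : Type*} [Field F] {x t : F} (hx : x ≠ 0) (hxt : x - t ≠ 0)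
    (K : ℕ) :
    (x - t)⁻¹ - ∑ k ∈ Finset.range K, t ^ k * (x ^ (k + 1))⁻¹ =
      (x ^ K)⁻¹ * ((x - t)⁻¹ * t ^ K) := by
  induction K with
  | zero => simp
  | succ K ih =>
    rw [Finset.sum_range_succ, ← sub_sub, ih]
    field_simp
    ring

lemma norm_integral_inv_sub_sub_sum_le {μ : Measure ℝ} {x : ℂ} {δ : ℝ} {K : ℕ} (hx : x ≠ 0)
    (hδ : 0 < δ) (hμ : ∀ k ≤ K, Integrable (fun t : ℝ => t ^ k) μ)
    (hdist : ∀ᵐ t : ℝ ∂μ, δ ≤ ‖x - t‖) :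
    ‖∫ t : ℝ, (x - t)⁻¹ ∂μ -
        ∑ k ∈ Finset.range K, ((∫ t, t ^ k ∂μ : ℝ) : ℂ) * (x ^ (k + 1))⁻¹‖ ≤
      (‖x‖ ^ K)⁻¹ * (δ⁻¹ * ∫ t, |t| ^ K ∂μ) := by
  have inv_le : ∀ᵐ t : ℝ ∂μ, ‖(x - t)⁻¹‖ ≤ δ⁻¹ := hdist.mono fun t ht => by
    rw [norm_inv]
    exact inv_anti₀ hδ ht
  have hμ' (k : ℕ) (hk : k ≤ K) : Integrable (fun t : ℝ => (t : ℂ) ^ k) μ := by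
    exact_mod_cast (hμ k hk).ofReal (𝕜 := ℂ)
  have hterm : ∀ k ∈ Finset.range K, Integrable (fun t : ℝ => (t : ℂ) ^ k * (x ^ (k + 1))⁻¹) μ :=
    fun k hk => (hμ' k (Finset.mem_range.1 hk).le).mul_const _
  have hinv : Integrable (fun t : ℝ => (x - t)⁻¹) μ := by
    simpa only [pow_zero, mul_one] using
      (hμ' 0 K.zero_le).bdd_mul (f := fun t : ℝ => (x - t)⁻¹) (by fun_prop) inv_le
  have remainder : ∫ t : ℝ, (x - t)⁻¹ ∂μ -
        ∑ k ∈ Finset.range K, ((∫ t, t ^ k ∂μ : ℝ) : ℂ) * (x ^ (k + 1))⁻¹ =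
      (x ^ K)⁻¹ * ∫ t : ℝ, (x - t)⁻¹ * (t : ℂ) ^ K ∂μ := by
    simp only [← integral_complex_ofReal, Complex.ofReal_pow, ← integral_mul_const]
    rw [← integral_finsetSum _ hterm, ← integral_sub hinv (integrable_finsetSum _ hterm),
      ← integral_const_mul]
    refine integral_congr_ae (hdist.mono fun t ht => ?_)
    exact inv_sub_sub_sum_geometric hx (norm_pos_iff.1 (hδ.trans_le ht)) K
  rw [remainder, norm_mul, norm_inv, norm_pow, ← integral_const_mul]
  gcongr
  refine norm_integral_le_of_norm_le ?_ (inv_le.mono fun t ht => ?_)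
  · simpa only [norm_pow, Real.norm_eq_abs] using (hμ K le_rfl).norm.const_mul δ⁻¹
  · rw [norm_mul, norm_pow, Complex.norm_real, Real.norm_eq_abs]
    gcongr

end StieltjesTransform

section AsymptoticExpansion

open Filter Asymptotics

variable {α 𝕜 : Type*} [NormedField 𝕜] {l : Filter α}

lemma eq_of_isBigO_sub_sum_asymptoticScale {u : ℕ → α → 𝕜}
    (hu : ∀ g, u (g + 1) =o[l] u g) (hu₀ : ∀ g, ∃ᶠ n in l, u g n ≠ 0) {f : α → 𝕜} {a b : ℕ → 𝕜}
    (ha : ∀ G, (fun n => f n - ∑ g ∈ Finset.range (G + 1), u g n * a g) =O[l] u (G + 1))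
    (hb : ∀ G, (fun n => f n - ∑ g ∈ Finset.range (G + 1), u g n * b g) =O[l] u (G + 1)) :
    a = b := by
  funext g
  induction g using Nat.strong_induction_on with
  | _ g ih =>
    by_contra hab
    have leading_term : (fun n => (b g - a g) * u g n) =O[l] u (g + 1) := by
      refine ((ha g).sub (hb g)).congr_left fun n => ?_
      rw [Finset.sum_range_succ, Finset.sum_range_succ,
        Finset.sum_congr rfl fun k hk => by rw [ih k (Finset.mem_range.1 hk)]]
      ring
    exact isLittleO_irrefl (hu₀ g) <|
      (isLittleO_const_mul_left_iff (sub_ne_zero.2 (Ne.symm hab))).1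
        (leading_term.trans_isLittleO (hu g))

end AsymptoticExpansion

noncomputable section

namespace Laguerre

section LaguerrePolynomials

open Polynomial

/-- The linear functional `X ^ n ↦ n!`, that is, `p ↦ ∫₀^∞ p(t) e⁻ᵗ dt`. -/
def gammaFunctional : ℝ[X] →ₗ[ℝ] ℝ :=
  Polynomial.lsum fun n => (n ! : ℝ) • LinearMap.id

lemma gammaFunctional_monomial (n : ℕ) (a : ℝ) : gammaFunctional (monomial n a) = n ! * a := by
  simp [gammaFunctional, Polynomial.lsum_apply, Polynomial.sum_monomial_index]

lemma gammaFunctional_C_mul (a : ℝ) (q : ℝ[X]) :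
    gammaFunctional (C a * q) = a * gammaFunctional q := by
  rw [← smul_eq_C_mul, map_smul, smul_eq_mul]

lemma gammaFunctional_derivative (q : ℝ[X]) :
    gammaFunctional (derivative q) = gammaFunctional q - q.coeff 0 := by
  induction q using Polynomial.induction_on' with
  | add p q hp hq =>
    simp only [map_add, coeff_add, hp, hq]
    ring
  | monomial n a =>
    cases n with
    | zero => simp [derivative_monomial, gammaFunctional_monomial, -monomial_zero_left]
    | succ n =>
      simp only [derivative_monomial, gammaFunctional_monomial, Nat.factorial_succ,
        coeff_monomial_of_ne a n.succ_ne_zero.symm, Nat.add_sub_cancel, sub_zero]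
      push_cast
      ring

lemma gammaFunctional_X_pow_mul (k : ℕ) (q : ℝ[X]) :
    gammaFunctional (X ^ k * (X * derivative q + (1 - X) * q)) =
      -k * gammaFunctional (X ^ k * q) := by
  have product_rule : derivative (X * (X ^ k * q)) =
      X ^ k * (X * derivative q + (1 - X) * q) + C (k : ℝ) * (X ^ k * q) + X * (X ^ k * q) := by
    cases k with
    | zero => simp; ring
    | succ k =>
      simp only [derivative_mul, derivative_X, derivative_X_pow_succ, Nat.cast_succ, C_add, C_1]
      ring
  have by_parts := gammaFunctional_derivative (X * (X ^ k * q))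
  rw [product_rule, map_add, map_add, gammaFunctional_C_mul, mul_coeff_zero, coeff_X_zero,
    zero_mul] at by_parts
  linarith

/-- The Laguerre polynomial of degree `n` (with parameter `0`). -/
def laguerrePoly (n : ℕ) : ℝ[X] :=
  ∑ k ∈ Finset.range (n + 1), monomial k ((-1 : ℝ) ^ k * n.choose k / k !)

lemma coeff_laguerrePoly (n k : ℕ) :
    (laguerrePoly n).coeff k = (-1 : ℝ) ^ k * n.choose k / k ! := by
  simp only [laguerrePoly, finsetSum_coeff, coeff_monomial]
  rw [Finset.sum_ite_eq']
  split_ifs with h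
  · rfl
  · rw [Nat.choose_eq_zero_of_lt (by simpa using h)]
    simp

lemma laguerrePoly_zero : laguerrePoly 0 = 1 := by
  simp [laguerrePoly]

lemma natDegree_laguerrePoly (n : ℕ) : (laguerrePoly n).natDegree = n := by
  refine natDegree_eq_of_le_of_coeff_ne_zero (natDegree_le_iff_coeff_eq_zero.2 fun k hk => ?_) ?_
  · rw [coeff_laguerrePoly, Nat.choose_eq_zero_of_lt hk]
    simp
  · simp [coeff_laguerrePoly, Nat.factorial_ne_zero]

lemma derivative_laguerrePoly_succ (n : ℕ) :
    derivative (laguerrePoly (n + 1)) = derivative (laguerrePoly n) - laguerrePoly n := by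
  ext k
  simp only [coeff_derivative, coeff_sub, coeff_laguerrePoly, Nat.choose_succ_succ,
    Nat.factorial_succ]
  push_cast
  field_simp
  ring

lemma X_mul_derivative_laguerrePoly_succ (n : ℕ) :
    X * derivative (laguerrePoly (n + 1)) =
      C ((n : ℝ) + 1) * (laguerrePoly (n + 1) - laguerrePoly n) := by
  ext k
  rw [coeff_C_mul, coeff_sub]
  cases k with
  | zero => simp [coeff_laguerrePoly]
  | succ k =>
    have absorption : ((n : ℝ) + 1) * n.choose k = (n + 1).choose (k + 1) * (k + 1) := by
      exact_mod_cast Nat.add_one_mul_choose_eq n k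
    have pascal : ((n + 1).choose (k + 1) : ℝ) = n.choose k + n.choose (k + 1) := by
      exact_mod_cast Nat.choose_succ_succ n k
    simp only [coeff_X_mul, coeff_derivative, coeff_laguerrePoly, Nat.factorial_succ]
    push_cast
    field_simp
    linear_combination -absorption - (n + 1) * pascal

lemma X_mul_derivative_laguerrePoly (n : ℕ) :
    X * derivative (laguerrePoly n) =
      C ((n : ℝ) + 1) * (laguerrePoly (n + 1) - laguerrePoly n) + X * laguerrePoly n := by
  rw [← X_mul_derivative_laguerrePoly_succ, derivative_laguerrePoly_succ]
  ring

lemma laguerrePoly_one : laguerrePoly 1 = 1 - X := by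
  have h := X_mul_derivative_laguerrePoly 0
  simp only [laguerrePoly_zero, derivative_one, mul_zero, Nat.cast_zero, zero_add, map_one,
    one_mul, mul_one] at h
  linear_combination -h

lemma X_mul_derivative_sum_laguerrePoly_sq (n : ℕ) :
    X * derivative (∑ m ∈ Finset.range (n + 1), laguerrePoly m * laguerrePoly m) +
        (1 - X) * ∑ m ∈ Finset.range (n + 1), laguerrePoly m * laguerrePoly m =
      C ((n : ℝ) + 1) * (laguerrePoly (n + 1) * laguerrePoly n) := by
  induction n with
  | zero => simp [laguerrePoly_zero, laguerrePoly_one]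
  | succ n ih =>
    have lower := X_mul_derivative_laguerrePoly_succ n
    have upper := X_mul_derivative_laguerrePoly (n + 1)
    rw [Finset.sum_range_succ, derivative_add, derivative_mul]
    simp only [Nat.cast_succ, C_add, C_1] at ih lower upper ⊢
    linear_combination ih + laguerrePoly (n + 1) * (lower + upper)

lemma gammaFunctional_laguerrePoly_succ_mul (n : ℕ) (q : ℝ[X]) :
    gammaFunctional (laguerrePoly (n + 1) * q) =
      gammaFunctional (laguerrePoly (n + 1) * derivative q) -
        gammaFunctional (laguerrePoly n * derivative q) := by
  have coeff_zero (m : ℕ) : (laguerrePoly m * q).coeff 0 = q.coeff 0 := by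
    simp [mul_coeff_zero, coeff_laguerrePoly]
  have upper := gammaFunctional_derivative (laguerrePoly (n + 1) * q)
  have lower := gammaFunctional_derivative (laguerrePoly n * q)
  rw [derivative_mul, map_add, coeff_zero] at upper lower
  rw [derivative_laguerrePoly_succ, sub_mul, map_sub] at upper
  linarith

lemma gammaFunctional_laguerrePoly_mul_eq_zero {n : ℕ} {q : ℝ[X]} (hq : q.degree < n) :
    gammaFunctional (laguerrePoly n * q) = 0 := by
  suffices h : ∀ (d : ℕ) {n : ℕ} {q : ℝ[X]}, q.degree < d → d ≤ n →
      gammaFunctional (laguerrePoly n * q) = 0 from h n hq le_rfl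
  intro d
  induction d with
  | zero =>
    intro n q hq _
    have hq0 : q = 0 := by simpa using hq
    rw [hq0, mul_zero, map_zero]
  | succ d ih =>
    intro n q hq hn
    obtain ⟨n, rfl⟩ := Nat.exists_eq_add_of_lt hn
    have hq' : (derivative q).degree < d := by
      rw [degree_lt_iff_coeff_zero] at hq ⊢
      intro k hk
      rw [coeff_derivative, hq (k + 1) (by omega), zero_mul]
    rw [gammaFunctional_laguerrePoly_succ_mul, ih hq' (by omega), ih hq' (by omega), sub_zero]

lemma degree_laguerrePoly (n : ℕ) : (laguerrePoly n).degree = n := by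
  have ne_zero : laguerrePoly n ≠ 0 := fun h => by
    simpa [h] using coeff_laguerrePoly n 0
  rw [degree_eq_natDegree ne_zero, natDegree_laguerrePoly]

lemma gammaFunctional_laguerrePoly_mul_self (n : ℕ) :
    gammaFunctional (laguerrePoly n * laguerrePoly n) = 1 := by
  have orthogonal_derivative (m : ℕ) :
      gammaFunctional (laguerrePoly m * derivative (laguerrePoly m)) = 0 :=
    gammaFunctional_laguerrePoly_mul_eq_zero <| degree_laguerrePoly m ▸
      degree_derivative_lt fun h => by simpa [h] using degree_laguerrePoly m
  induction n with
  | zero => rw [laguerrePoly_zero, mul_one, ← monomial_zero_one, gammaFunctional_monomial]; simp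
  | succ n ih =>
    rw [gammaFunctional_laguerrePoly_succ_mul, orthogonal_derivative,
      derivative_laguerrePoly_succ, mul_sub, map_sub, orthogonal_derivative, ih]
    norm_num

lemma gammaFunctional_laguerrePoly_mul (m n : ℕ) :
    gammaFunctional (laguerrePoly m * laguerrePoly n) = if m = n then 1 else 0 := by
  rcases lt_trichotomy m n with h | rfl | h
  · rw [mul_comm, if_neg h.ne, gammaFunctional_laguerrePoly_mul_eq_zero]
    rw [degree_laguerrePoly]
    exact_mod_cast h
  · rw [gammaFunctional_laguerrePoly_mul_self, if_pos rfl]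
  · rw [if_neg h.ne', gammaFunctional_laguerrePoly_mul_eq_zero]
    rw [degree_laguerrePoly]
    exact_mod_cast h

end LaguerrePolynomials

section TraceMoments

open Polynomial

/-- The moment `∫₀^∞ tᵏ L_m(t) L_n(t) e⁻ᵗ dt`. -/
def laguerreMoment (m n k : ℕ) : ℝ :=
  gammaFunctional (X ^ k * (laguerrePoly m * laguerrePoly n))

/-- The `k`-th moment `∑_{m < N} ∫₀^∞ tᵏ L_m(t)² e⁻ᵗ dt` of the one-point density of the unscaled
`N × N` Laguerre ensemble, whose weight is `e⁻ᵗ` instead of `e^{-Nt}`. -/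
def traceMoment (N k : ℕ) : ℝ :=
  ∑ m ∈ Finset.range N, laguerreMoment m m k

lemma laguerreMoment_zero_right (m n : ℕ) : laguerreMoment m n 0 = if m = n then 1 else 0 := by
  rw [laguerreMoment, pow_zero, one_mul, gammaFunctional_laguerrePoly_mul]

lemma laguerreMoment_succ_succ_succ (n k : ℕ) :
    laguerreMoment (n + 1) (n + 1) (k + 1) =
      (2 * ((n : ℝ) + 1) + k + 1) * laguerreMoment (n + 1) (n + 1) k -
        2 * ((n : ℝ) + 1) * laguerreMoment (n + 1) n k := by
  have h := gammaFunctional_X_pow_mul k (laguerrePoly (n + 1) * laguerrePoly (n + 1))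
  have expand : X ^ k * (X * derivative (laguerrePoly (n + 1) * laguerrePoly (n + 1)) +
      (1 - X) * (laguerrePoly (n + 1) * laguerrePoly (n + 1))) =
      C (2 * ((n : ℝ) + 1)) * (X ^ k * (laguerrePoly (n + 1) * laguerrePoly (n + 1)) -
        X ^ k * (laguerrePoly (n + 1) * laguerrePoly n)) +
      (X ^ k * (laguerrePoly (n + 1) * laguerrePoly (n + 1)) -
        X ^ (k + 1) * (laguerrePoly (n + 1) * laguerrePoly (n + 1))) := by
    rw [derivative_mul, C_mul, C_ofNat]
    linear_combination 2 * X ^ k * laguerrePoly (n + 1) * X_mul_derivative_laguerrePoly_succ n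
  rw [expand, map_add, gammaFunctional_C_mul, map_sub, map_sub] at h
  simp only [laguerreMoment]
  linarith

lemma laguerreMoment_self_succ (n k : ℕ) :
    laguerreMoment n n (k + 1) =
      (2 * ((n : ℝ) + 1) - (k + 1)) * laguerreMoment n n k -
        2 * ((n : ℝ) + 1) * laguerreMoment (n + 1) n k := by
  have h := gammaFunctional_X_pow_mul k (laguerrePoly n * laguerrePoly n)
  have expand : X ^ k * (X * derivative (laguerrePoly n * laguerrePoly n) +
      (1 - X) * (laguerrePoly n * laguerrePoly n)) =
      C (2 * ((n : ℝ) + 1)) * (X ^ k * (laguerrePoly (n + 1) * laguerrePoly n) -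
        X ^ k * (laguerrePoly n * laguerrePoly n)) +
      (X ^ k * (laguerrePoly n * laguerrePoly n) +
        X ^ (k + 1) * (laguerrePoly n * laguerrePoly n)) := by
    rw [derivative_mul, C_mul, C_ofNat]
    linear_combination 2 * X ^ k * laguerrePoly n * X_mul_derivative_laguerrePoly n
  rw [expand, map_add, gammaFunctional_C_mul, map_sub, map_add] at h
  simp only [laguerreMoment]
  linarith

lemma mul_laguerreMoment_succ_sub_self (n k : ℕ) :
    ((n : ℝ) + 1) * (laguerreMoment (n + 1) (n + 1) k - laguerreMoment n n k) =
      -(k + 1) * laguerreMoment (n + 1) n k := by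
  have h := gammaFunctional_X_pow_mul k (laguerrePoly (n + 1) * laguerrePoly n)
  have expand : X ^ k * (X * derivative (laguerrePoly (n + 1) * laguerrePoly n) +
      (1 - X) * (laguerrePoly (n + 1) * laguerrePoly n)) =
      C ((n : ℝ) + 1) * (X ^ k * (laguerrePoly (n + 1) * laguerrePoly (n + 1)) -
        X ^ k * (laguerrePoly n * laguerrePoly n)) +
      X ^ k * (laguerrePoly (n + 1) * laguerrePoly n) := by
    rw [derivative_mul]
    linear_combination X ^ k * laguerrePoly (n + 1) * X_mul_derivative_laguerrePoly n +
      X ^ k * laguerrePoly n * X_mul_derivative_laguerrePoly_succ n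
  rw [expand, map_add, gammaFunctional_C_mul, map_sub] at h
  simp only [laguerreMoment]
  linarith

lemma mul_laguerreMoment_succ_self (n k : ℕ) :
    ((n : ℝ) + 1) * laguerreMoment (n + 1) n k = -k * traceMoment (n + 1) k := by
  have h := gammaFunctional_X_pow_mul k
    (∑ m ∈ Finset.range (n + 1), laguerrePoly m * laguerrePoly m)
  rwa [X_mul_derivative_sum_laguerrePoly_sq, mul_left_comm, gammaFunctional_C_mul,
    Finset.mul_sum, map_sum] at h

lemma sq_mul_laguerreMoment_succ_sub_self (n k : ℕ) :
    ((n : ℝ) + 1) ^ 2 * (laguerreMoment (n + 1) (n + 1) k - laguerreMoment n n k) =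
      k * (k + 1) * traceMoment (n + 1) k := by
  linear_combination ((n : ℝ) + 1) * mul_laguerreMoment_succ_sub_self n k -
    ((k : ℝ) + 1) * mul_laguerreMoment_succ_self n k

lemma laguerreMoment_succ_sub_self_recurrence (n k : ℕ) :
    ((k : ℝ) + 1) * (laguerreMoment (n + 1) (n + 1) (k + 2) - laguerreMoment n n (k + 2)) =
      2 * ((n : ℝ) + 1) * (2 * k + 3) *
          (laguerreMoment (n + 1) (n + 1) (k + 1) - laguerreMoment n n (k + 1)) +
        ((k : ℝ) + 1) ^ 2 * (k + 2) *
          (laguerreMoment (n + 1) (n + 1) k - laguerreMoment n n k) := by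
  have upper₀ := laguerreMoment_succ_succ_succ n k
  have upper₁ := laguerreMoment_succ_succ_succ n (k + 1)
  have lower₀ := laguerreMoment_self_succ n k
  have lower₁ := laguerreMoment_self_succ n (k + 1)
  have gap := mul_laguerreMoment_succ_sub_self n k
  push_cast at upper₁ lower₁
  linear_combination ((k : ℝ) + 1) * (upper₁ - lower₁) +
    ((k : ℝ) + 1) * (k + 2) * (upper₀ + lower₀) -
    2 * ((n : ℝ) + 1) * (k + 2) * (upper₀ - lower₀) - 4 * ((n : ℝ) + 1) * (k + 2) * gap

/-- The recursion of Haagerup and Thorbjørnsen. -/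
lemma traceMoment_recurrence (N k : ℕ) :
    ((k : ℝ) + 3) * traceMoment N (k + 2) =
      2 * N * (2 * k + 3) * traceMoment N (k + 1) +
        ((k : ℝ) + 1) ^ 2 * k * traceMoment N k := by
  cases N with
  | zero => simp [traceMoment]
  | succ n =>
    have gap (j : ℕ) := sq_mul_laguerreMoment_succ_sub_self n j
    have gap_rec := laguerreMoment_succ_sub_self_recurrence n k
    have gap₁ := gap (k + 1)
    have gap₂ := gap (k + 2)
    have scaled : ((k : ℝ) + 1) * (k + 2) * (((k : ℝ) + 3) * traceMoment (n + 1) (k + 2)) =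
        ((k : ℝ) + 1) * (k + 2) * (2 * (n + 1) * (2 * k + 3) * traceMoment (n + 1) (k + 1) +
          ((k : ℝ) + 1) ^ 2 * k * traceMoment (n + 1) k) := by
      push_cast at gap₁ gap₂
      linear_combination ((n : ℝ) + 1) ^ 2 * gap_rec - ((k : ℝ) + 1) * gap₂ +
        2 * ((n : ℝ) + 1) * (2 * k + 3) * gap₁ + ((k : ℝ) + 1) ^ 2 * (k + 2) * gap k
    push_cast
    exact mul_left_cancel₀ (by positivity) scaled

lemma traceMoment_zero_right (N : ℕ) : traceMoment N 0 = N := by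
  simp [traceMoment, laguerreMoment_zero_right]

lemma traceMoment_one_right (N : ℕ) : traceMoment N 1 = (N : ℝ) ^ 2 := by
  cases N with
  | zero => simp [traceMoment]
  | succ n =>
    have upper := laguerreMoment_succ_succ_succ n 0
    have lower := laguerreMoment_self_succ n 0
    have gap := sq_mul_laguerreMoment_succ_sub_self n 1
    simp only [laguerreMoment_zero_right, if_true, if_neg n.succ_ne_self, Nat.cast_zero,
      Nat.cast_one] at upper lower gap
    push_cast
    linear_combination -gap / 2 + ((n : ℝ) + 1) ^ 2 / 2 * (upper - lower)

end TraceMoments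

section OnePointMeasure

open MeasureTheory Polynomial

lemma integrableOn_pow_mul_exp_neg (n : ℕ) :
    IntegrableOn (fun t : ℝ => t ^ n * Real.exp (-t)) (Set.Ioi 0) := by
  simpa [mul_comm] using Real.GammaIntegral_convergent (s := n + 1) (by positivity)

lemma integrableOn_eval_mul_exp_neg (q : ℝ[X]) :
    IntegrableOn (fun t : ℝ => q.eval t * Real.exp (-t)) (Set.Ioi 0) := by
  simp only [eval_eq_sum_range, Finset.sum_mul, mul_assoc]
  exact integrable_finsetSum _ fun n _ => (integrableOn_pow_mul_exp_neg n).const_mul _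

lemma integral_eval_mul_exp_neg (q : ℝ[X]) :
    ∫ t in Set.Ioi (0 : ℝ), q.eval t * Real.exp (-t) = gammaFunctional q := by
  induction q using Polynomial.induction_on' with
  | add p q hp hq =>
    simp only [eval_add, add_mul, map_add]
    rw [integral_add (integrableOn_eval_mul_exp_neg p) (integrableOn_eval_mul_exp_neg q), hp, hq]
  | monomial n a =>
    simp only [eval_monomial, mul_assoc]
    rw [integral_const_mul, gammaFunctional_monomial, ← Real.Gamma_nat_eq_factorial,
      Real.Gamma_eq_integral (by positivity), mul_comm a]
    simp [mul_comm]

variable {c : ℝ}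

lemma integrableOn_eval_mul_mul_exp_neg_mul (q : ℝ[X]) (hc : 0 < c) :
    IntegrableOn (fun t : ℝ => q.eval (c * t) * Real.exp (-(c * t))) (Set.Ici 0) := by
  rw [integrableOn_Ici_iff_integrableOn_Ioi]
  refine (integrableOn_Ioi_comp_mul_left_iff (fun t => q.eval t * Real.exp (-t)) 0 hc).2 ?_
  rw [mul_zero]
  exact integrableOn_eval_mul_exp_neg q

lemma integral_eval_mul_mul_exp_neg_mul (q : ℝ[X]) (hc : 0 < c) :
    ∫ t in Set.Ici (0 : ℝ), q.eval (c * t) * Real.exp (-(c * t)) = c⁻¹ * gammaFunctional q := by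
  rw [integral_Ici_eq_integral_Ioi,
    integral_comp_mul_left_Ioi (fun t : ℝ => q.eval t * Real.exp (-t)) 0 hc, mul_zero,
    integral_eval_mul_exp_neg, smul_eq_mul]

/-- The Laguerre polynomials of the scaled ensemble. Together with `dualLaguerre N` they form a
biorthonormal system on `[0, ∞)`; the whole weight is put into the second family. -/
def scaledLaguerre (N m : ℕ) (t : ℝ) : ℝ :=
  (laguerrePoly m).eval (N * t)

/-- The functions dual to `scaledLaguerre N` on `[0, ∞)`. -/
def dualLaguerre (N m : ℕ) (t : ℝ) : ℝ :=
  N * Real.exp (-(N * t)) * scaledLaguerre N m t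

/-- The density `∑_{m < N} N L_m(Nt)² e^{-Nt}` of the one-point measure, of total mass `N`. -/
def density (N : ℕ) (t : ℝ) : ℝ :=
  ∑ m ∈ Finset.range N, scaledLaguerre N m t * dualLaguerre N m t

/-- The expected counting measure of the eigenvalues of the `N × N` Laguerre ensemble. -/
def onePointMeasure (N : ℕ) : Measure ℝ :=
  (volume.restrict (Set.Ici 0)).withDensity fun t => ENNReal.ofReal (density N t)

variable {N : ℕ}

lemma pow_mul_scaledLaguerre_mul_dualLaguerre (N m n k : ℕ) (t : ℝ) :
    (N * t) ^ k * (scaledLaguerre N m t * dualLaguerre N n t) =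
      N * ((X ^ k * (laguerrePoly m * laguerrePoly n)).eval (N * t) * Real.exp (-(N * t))) := by
  simp only [scaledLaguerre, dualLaguerre, eval_mul, eval_pow, eval_X]
  ring

lemma scaledLaguerre_mul_dualLaguerre (N m n : ℕ) (t : ℝ) :
    scaledLaguerre N m t * dualLaguerre N n t =
      N * ((laguerrePoly m * laguerrePoly n).eval (N * t) * Real.exp (-(N * t))) := by
  simpa using pow_mul_scaledLaguerre_mul_dualLaguerre N m n 0 t

lemma integrableOn_scaledLaguerre_mul_dualLaguerre (hN : 0 < N) (m n : ℕ) :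
    IntegrableOn (fun t => scaledLaguerre N m t * dualLaguerre N n t) (Set.Ici 0) := by
  simp only [scaledLaguerre_mul_dualLaguerre]
  exact (integrableOn_eval_mul_mul_exp_neg_mul _ (by positivity)).const_mul _

lemma integral_scaledLaguerre_mul_dualLaguerre (hN : 0 < N) (m n : ℕ) :
    ∫ t in Set.Ici 0, scaledLaguerre N m t * dualLaguerre N n t = if m = n then 1 else 0 := by
  have hN' : (0 : ℝ) < N := by positivity
  simp only [scaledLaguerre_mul_dualLaguerre]
  rw [integral_const_mul, integral_eval_mul_mul_exp_neg_mul _ hN',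
    gammaFunctional_laguerrePoly_mul, mul_inv_cancel_left₀ hN'.ne']

lemma det_scaledLaguerre (N : ℕ) (l : Fin N → ℝ) :
    (Matrix.of fun a b : Fin N => scaledLaguerre N a (l b)).det =
      (∏ j : Fin N, (laguerrePoly j).coeff j) * (∏ i : Fin N, ∏ _j ∈ Finset.Ioi i, (N : ℝ)) *
        ∏ i, ∏ j ∈ Finset.Ioi i, (l j - l i) := by
  have h := det_eval_of_natDegree_le (fun j : Fin N => laguerrePoly j)
    (fun j => (natDegree_laguerrePoly j).le) fun i => N * l i
  rw [← Matrix.det_transpose, Matrix.det_vandermonde] at h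
  simp only [← mul_sub, Finset.prod_mul_distrib, ← mul_assoc] at h
  exact h

lemma det_dualLaguerre (N : ℕ) (l : Fin N → ℝ) :
    (Matrix.of fun a b : Fin N => dualLaguerre N a (l b)).det =
      (N : ℝ) ^ N * Real.exp (-(N : ℝ) * ∑ i, l i) *
        (Matrix.of fun a b : Fin N => scaledLaguerre N a (l b)).det := by
  have factor : ∏ i, (N : ℝ) * Real.exp (-(N * l i)) =
      (N : ℝ) ^ N * Real.exp (-(N : ℝ) * ∑ i, l i) := by
    rw [Finset.prod_mul_distrib, Finset.prod_const, Finset.card_univ, Fintype.card_fin,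
      ← Real.exp_sum, Finset.mul_sum]
    simp only [neg_mul]
  rw [← factor, ← Matrix.det_mul_row]
  rfl

lemma exists_weight_eq_det_mul_det (hN : 0 < N) : ∃ κ : ℝ, κ ≠ 0 ∧ ∀ l : Fin N → ℝ,
    weight N l = κ * ((Matrix.of fun a b : Fin N => scaledLaguerre N a (l b)).det *
      (Matrix.of fun a b : Fin N => dualLaguerre N a (l b)).det) := by
  have hN' : (N : ℝ) ≠ 0 := by positivity
  have leading_ne_zero (j : Fin N) : (laguerrePoly j).coeff j ≠ 0 := by
    simp [coeff_laguerrePoly, Nat.factorial_ne_zero]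
  let β : ℝ := (∏ j : Fin N, (laguerrePoly j).coeff j) *
    ∏ i : Fin N, ∏ _j ∈ Finset.Ioi i, (N : ℝ)
  have hβ : β ≠ 0 := mul_ne_zero (Finset.prod_ne_zero_iff.2 fun j _ => leading_ne_zero j)
    (Finset.prod_ne_zero_iff.2 fun _ _ => Finset.prod_ne_zero_iff.2 fun _ _ => hN')
  refine ⟨((N : ℝ) ^ N * β ^ 2)⁻¹, by positivity, fun l => ?_⟩
  have sq_swap : (∏ i, ∏ j ∈ Finset.Ioi i, (l i - l j)) ^ 2 =
      (∏ i, ∏ j ∈ Finset.Ioi i, (l j - l i)) ^ 2 := by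
    simp only [← Finset.prod_pow, sub_sq_comm]
  rw [det_dualLaguerre, det_scaledLaguerre, weight, sq_swap]
  change _ = _ * (β * _ * (_ * (β * _)))
  field_simp

lemma exists_ofReal_weight_eq_det_mul_det (hN : 0 < N) :
    ∃ κ : ℂ, κ ≠ 0 ∧ ∀ l : Fin N → ℝ, ((weight N l : ℝ) : ℂ) =
      κ * ((Matrix.of fun a b : Fin N => (scaledLaguerre N a (l b) : ℂ)).det *
        (Matrix.of fun a b : Fin N => (dualLaguerre N a (l b) : ℂ)).det) := by
  obtain ⟨κ, hκ, hw⟩ := exists_weight_eq_det_mul_det hN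
  refine ⟨κ, Complex.ofReal_ne_zero.2 hκ, fun l => ?_⟩
  rw [hw, Complex.ofReal_mul, Complex.ofReal_mul, ← Complex.ofRealHom_eq_coe (Matrix.det _),
    ← Complex.ofRealHom_eq_coe (Matrix.det _), RingHom.map_det, RingHom.map_det]
  rfl

lemma volume_restrict_domain (N : ℕ) : (volume : Measure (Fin N → ℝ)).restrict (domain N) =
    Measure.pi fun _ => (volume : Measure ℝ).restrict (Set.Ici 0) := by
  rw [← Measure.restrict_pi_pi, ← volume_pi]
  congr 1
  ext l
  simp only [domain, Set.mem_ofPred_eq, Set.mem_univ_pi, Set.mem_Ici]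

lemma measurable_density (N : ℕ) : Measurable (density N) := by
  unfold density dualLaguerre scaledLaguerre
  fun_prop

lemma density_nonneg (N : ℕ) (t : ℝ) : 0 ≤ density N t := by
  refine Finset.sum_nonneg fun m _ => ?_
  rw [dualLaguerre, mul_left_comm]
  exact mul_nonneg (by positivity) (mul_self_nonneg _)

lemma integral_onePointMeasure {E : Type*} [NormedAddCommGroup E] [NormedSpace ℝ E] (N : ℕ)
    (f : ℝ → E) : ∫ t, f t ∂(onePointMeasure N) = ∫ t in Set.Ici 0, density N t • f t := by
  rw [onePointMeasure, integral_withDensity_eq_integral_toReal_smul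
    (measurable_density N).ennreal_ofReal (.of_forall fun _ => ENNReal.ofReal_lt_top)]
  simp only [ENNReal.toReal_ofReal (density_nonneg N _)]

lemma integrable_onePointMeasure_iff {E : Type*} [NormedAddCommGroup E] [NormedSpace ℝ E]
    (f : ℝ → E) :
    Integrable f (onePointMeasure N) ↔ IntegrableOn (fun t => density N t • f t) (Set.Ici 0) := by
  rw [onePointMeasure, integrable_withDensity_iff_integrable_smul'
    (measurable_density N).ennreal_ofReal (.of_forall fun _ => ENNReal.ofReal_lt_top)]
  simp only [ENNReal.toReal_ofReal (density_nonneg N _)]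
  rfl

lemma ae_onePointMeasure_nonneg (N : ℕ) : ∀ᵐ t ∂(onePointMeasure N), 0 ≤ t :=
  (withDensity_absolutelyContinuous _ _).ae_le (ae_restrict_mem measurableSet_Ici)

lemma integrableOn_ofReal_scaledLaguerre_mul_dualLaguerre (hN : 0 < N) (m n : ℕ) :
    IntegrableOn (fun t => (scaledLaguerre N m t : ℂ) * dualLaguerre N n t) (Set.Ici 0) := by
  simp only [← Complex.ofReal_mul]
  exact (integrableOn_scaledLaguerre_mul_dualLaguerre hN m n).ofReal

lemma integral_ofReal_scaledLaguerre_mul_dualLaguerre (hN : 0 < N) (m n : ℕ) :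
    ∫ t in Set.Ici 0, (scaledLaguerre N m t : ℂ) * dualLaguerre N n t =
      if m = n then 1 else 0 := by
  simp only [← Complex.ofReal_mul]
  rw [integral_complex_ofReal, integral_scaledLaguerre_mul_dualLaguerre hN]
  split_ifs <;> simp

lemma ofReal_density_mul (N : ℕ) (t : ℝ) (z : ℂ) :
    (density N t : ℂ) * z =
      ∑ a : Fin N, (scaledLaguerre N a t : ℂ) * (dualLaguerre N a t * z) := by
  simp only [density, Finset.sum_range, Complex.ofReal_sum, Complex.ofReal_mul, Finset.sum_mul,
    mul_assoc]

lemma mean_linearStatistic_eq_integral (hN : 0 < N) {f : ℝ → ℂ} (hf : Measurable f) {B : ℝ}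
    (hB : ∀ t, 0 ≤ t → ‖f t‖ ≤ B) :
    ((partitionFunction N : ℝ) : ℂ)⁻¹ *
        ∫ l in domain N, ((weight N l : ℝ) : ℂ) * ∑ i, f (l i) =
      ∫ t, f t ∂(onePointMeasure N) := by
  obtain ⟨κ, hκ, hw⟩ := exists_ofReal_weight_eq_det_mul_det hN
  have integrable (a b : Fin N) := integrableOn_ofReal_scaledLaguerre_mul_dualLaguerre hN a b
  have biorthonormal (a b : Fin N) : ∫ t in Set.Ici 0,
      (scaledLaguerre N a t : ℂ) * dualLaguerre N b t = if a = b then 1 else 0 := by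
    simp only [integral_ofReal_scaledLaguerre_mul_dualLaguerre hN, Fin.ext_iff]
  have integrable_mul (a b : Fin N) : IntegrableOn
      (fun t => (scaledLaguerre N a t : ℂ) * (dualLaguerre N b t * f t)) (Set.Ici 0) := by
    simp only [← mul_assoc]
    exact (integrable a b).mul_bdd hf.aestronglyMeasurable
      ((ae_restrict_mem measurableSet_Ici).mono hB)
  have partitionFunction_eq : ((partitionFunction N : ℝ) : ℂ) = κ * N ! := by
    rw [partitionFunction, ← integral_complex_ofReal, volume_restrict_domain]
    simp only [hw]
    rw [integral_const_mul, integral_det_mul_det_of_biorthonormal integrable biorthonormal,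
      Fintype.card_fin]
  have numerator_eq : ∫ l in domain N, ((weight N l : ℝ) : ℂ) * ∑ i, f (l i) =
      κ * (N ! * ∫ t, f t ∂(onePointMeasure N)) := by
    rw [volume_restrict_domain, integral_onePointMeasure]
    simp only [hw, mul_assoc κ, Complex.real_smul, ofReal_density_mul]
    rw [integral_const_mul, integral_det_mul_det_mul_sum_of_biorthonormal integrable
      biorthonormal integrable_mul, Fintype.card_fin,
      integral_finsetSum _ fun a _ => integrable_mul a a]
  have hκN : κ * N ! ≠ 0 := mul_ne_zero hκ (Nat.cast_ne_zero.2 N.factorial_ne_zero)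
  rw [partitionFunction_eq, numerator_eq, ← mul_assoc κ, inv_mul_cancel_left₀ hκN]

variable {x : ℂ} {δ : ℝ}

lemma oneLoopMean_eq_integral (hN : 0 < N) (hδ : 0 < δ) (hx : ∀ t : ℝ, 0 ≤ t → δ ≤ ‖x - t‖) :
    oneLoopMean N x = ∫ t : ℝ, (x - t)⁻¹ ∂(onePointMeasure N) := by
  refine mean_linearStatistic_eq_integral (f := fun t : ℝ => (x - t)⁻¹) hN (by fun_prop)
    (B := δ⁻¹) fun t ht => ?_
  rw [norm_inv]
  exact inv_anti₀ hδ (hx t ht)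

end OnePointMeasure

section NormalizedMoments

open MeasureTheory Polynomial

/-- The `k`-th moment of the one-point measure, divided by its total mass `N`. -/
def normalizedMoment (N k : ℕ) : ℝ :=
  traceMoment N k / (N : ℝ) ^ (k + 1)

variable {N : ℕ}

lemma density_mul_pow (hN : 0 < N) (k : ℕ) (t : ℝ) :
    density N t * t ^ k = ((N : ℝ) ^ k)⁻¹ * ∑ m ∈ Finset.range N, N *
      ((X ^ k * (laguerrePoly m * laguerrePoly m)).eval (N * t) * Real.exp (-(N * t))) := by
  simp only [← pow_mul_scaledLaguerre_mul_dualLaguerre, density, mul_pow, Finset.mul_sum,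
    Finset.sum_mul]
  refine Finset.sum_congr rfl fun m _ => ?_
  field_simp

lemma integrable_pow_onePointMeasure (hN : 0 < N) (k : ℕ) :
    Integrable (fun t : ℝ => t ^ k) (onePointMeasure N) := by
  simp only [integrable_onePointMeasure_iff, smul_eq_mul, density_mul_pow hN]
  exact (integrable_finsetSum _ fun m _ =>
    (integrableOn_eval_mul_mul_exp_neg_mul _ (by positivity)).const_mul _).const_mul _

lemma integral_pow_onePointMeasure (hN : 0 < N) (k : ℕ) :
    ∫ t, t ^ k ∂(onePointMeasure N) = N * normalizedMoment N k := by
  have hN' : (0 : ℝ) < N := by positivity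
  simp only [integral_onePointMeasure, smul_eq_mul, density_mul_pow hN]
  rw [integral_const_mul, integral_finsetSum _ fun m _ =>
    (integrableOn_eval_mul_mul_exp_neg_mul _ hN').const_mul _]
  simp only [integral_const_mul, integral_eval_mul_mul_exp_neg_mul _ hN', normalizedMoment,
    traceMoment, laguerreMoment, mul_inv_cancel_left₀ hN'.ne']
  field_simp
  ring

lemma norm_oneLoopMean_sub_sum_le (hN : 0 < N) {x : ℂ} {δ : ℝ} (hδ : 0 < δ)
    (hx : ∀ t : ℝ, 0 ≤ t → δ ≤ ‖x - t‖) (K : ℕ) :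
    ‖oneLoopMean N x - N * ∑ k ∈ Finset.range K, (normalizedMoment N k : ℂ) * (x ^ (k + 1))⁻¹‖ ≤
      (‖x‖ ^ K)⁻¹ * (δ⁻¹ * (N * normalizedMoment N K)) := by
  have hx0 : x ≠ 0 := norm_pos_iff.1 <| hδ.trans_le <| by simpa using hx 0 le_rfl
  have abs_moment : ∫ t, |t| ^ K ∂(onePointMeasure N) = N * normalizedMoment N K := by
    rw [← integral_pow_onePointMeasure hN]
    exact integral_congr_ae ((ae_onePointMeasure_nonneg N).mono fun t ht => by
      simp only [abs_of_nonneg ht])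
  have h := norm_integral_inv_sub_sub_sum_le hx0 hδ
    (fun k _ => integrable_pow_onePointMeasure hN k) ((ae_onePointMeasure_nonneg N).mono hx)
    (K := K)
  simpa only [← oneLoopMean_eq_integral hN hδ hx, abs_moment, integral_pow_onePointMeasure hN,
    Complex.ofReal_mul, Complex.ofReal_natCast, mul_assoc, ← Finset.mul_sum] using h

lemma normalizedMoment_zero_right (hN : 0 < N) : normalizedMoment N 0 = 1 := by
  rw [normalizedMoment, traceMoment_zero_right, zero_add, pow_one, div_self (by positivity)]

lemma normalizedMoment_one_right (hN : 0 < N) : normalizedMoment N 1 = 1 := by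
  rw [normalizedMoment, traceMoment_one_right, div_self (by positivity)]

lemma normalizedMoment_recurrence (hN : 0 < N) (k : ℕ) :
    ((k : ℝ) + 3) * normalizedMoment N (k + 2) =
      2 * (2 * k + 3) * normalizedMoment N (k + 1) +
        ((N : ℝ) ^ 2)⁻¹ * (((k : ℝ) + 1) ^ 2 * k * normalizedMoment N k) := by
  have hN' : (N : ℝ) ≠ 0 := by positivity
  simp only [normalizedMoment, pow_succ]
  field_simp
  linear_combination traceMoment_recurrence N k

end NormalizedMoments

section GenusCoefficients

/-- The coefficient of `N ^ (1 - 2 * g)` in the `k`-th moment of the one-point measure, defined by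
the recursion which the Haagerup–Thorbjørnsen recursion induces on coefficients. -/
def genusCoeff : ℕ → ℕ → ℝ
  | 0, 0 => 1
  | 0, _ + 1 => 0
  | 1, 0 => 1
  | 1, _ + 1 => 0
  | k + 2, 0 => 2 * (2 * k + 3) * genusCoeff (k + 1) 0 / (k + 3)
  | k + 2, g + 1 => (2 * (2 * k + 3) * genusCoeff (k + 1) (g + 1) +
      ((k : ℝ) + 1) ^ 2 * k * genusCoeff k g) / (k + 3)

lemma genusCoeff_recurrence_zero (k : ℕ) :
    ((k : ℝ) + 3) * genusCoeff (k + 2) 0 = 2 * (2 * k + 3) * genusCoeff (k + 1) 0 := by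
  rw [genusCoeff]
  field_simp

lemma genusCoeff_recurrence (k g : ℕ) :
    ((k : ℝ) + 3) * genusCoeff (k + 2) (g + 1) = 2 * (2 * k + 3) * genusCoeff (k + 1) (g + 1) +
      ((k : ℝ) + 1) ^ 2 * k * genusCoeff k g := by
  conv_lhs => rw [genusCoeff]
  field_simp

lemma genusCoeff_eq_zero {k g : ℕ} (hk : k ≤ 2 * g) (hg : 0 < g) : genusCoeff k g = 0 := by
  obtain ⟨g, rfl⟩ := Nat.exists_eq_succ_of_ne_zero hg.ne'
  induction k using Nat.twoStepInduction generalizing g with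
  | zero | one => rw [genusCoeff]
  | more k ih₀ ih₁ =>
    rw [genusCoeff, ih₁ g (by omega) hg]
    cases g with
    | zero =>
      obtain rfl : k = 0 := by omega
      simp
    | succ g => simp [ih₀ g (by omega) g.succ_pos]

lemma genusCoeff_nonneg (k g : ℕ) : 0 ≤ genusCoeff k g := by
  induction k using Nat.twoStepInduction generalizing g with
  | zero | one => cases g <;> simp [genusCoeff]
  | more k ih₀ ih₁ =>
    cases g with
    | zero =>
      have := ih₁ 0
      rw [genusCoeff]
      positivity
    | succ g =>
      have := ih₁ (g + 1)
      have := ih₀ g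
      rw [genusCoeff]
      positivity

lemma genusCoeff_zero_le (k : ℕ) : genusCoeff (k + 2) 0 ≤ 4 * genusCoeff (k + 1) 0 := by
  have := genusCoeff_nonneg (k + 1) 0
  refine le_of_mul_le_mul_left ?_ (by positivity : (0 : ℝ) < k + 3)
  rw [genusCoeff_recurrence_zero]
  nlinarith

lemma genusCoeff_succ_le (k g : ℕ) :
    genusCoeff (k + 2) (g + 1) ≤
      4 * genusCoeff (k + 1) (g + 1) + ((k : ℝ) + 1) ^ 2 * genusCoeff k g := by
  have := genusCoeff_nonneg (k + 1) (g + 1)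
  have : 0 ≤ ((k : ℝ) + 1) ^ 2 * genusCoeff k g :=
    mul_nonneg (by positivity) (genusCoeff_nonneg k g)
  refine le_of_mul_le_mul_left ?_ (by positivity : (0 : ℝ) < k + 3)
  rw [genusCoeff_recurrence]
  linarith

/-- Bernoulli's inequality, applied to `(k + 2)³ ≥ (k + 1)³ + (k + 1)²`. -/
lemma cube_pow_add_le (k g : ℕ) :
    (((k : ℝ) + 1) ^ 3) ^ (g + 1) + (g + 1) * (((k : ℝ) + 1) ^ 2 * ((k : ℝ) ^ 3) ^ g) ≤
      (((k : ℝ) + 2) ^ 3) ^ (g + 1) := by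
  have bernoulli := pow_add_mul_le_add_pow (a := ((k : ℝ) + 1) ^ 3) (b := ((k : ℝ) + 1) ^ 2)
    (by positivity) (by positivity) (g + 1)
  rw [Nat.add_sub_cancel, Nat.cast_succ] at bernoulli
  calc (((k : ℝ) + 1) ^ 3) ^ (g + 1) + (g + 1) * (((k : ℝ) + 1) ^ 2 * ((k : ℝ) ^ 3) ^ g)
      ≤ (((k : ℝ) + 1) ^ 3) ^ (g + 1) +
          (g + 1) * (((k : ℝ) + 1) ^ 2 * (((k : ℝ) + 1) ^ 3) ^ g) := by
        gcongr
        exact le_add_of_nonneg_right zero_le_one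
    _ ≤ (((k : ℝ) + 1) ^ 3 + ((k : ℝ) + 1) ^ 2) ^ (g + 1) := by linarith
    _ ≤ (((k : ℝ) + 2) ^ 3) ^ (g + 1) := by
        gcongr
        nlinarith [(Nat.cast_nonneg k : (0 : ℝ) ≤ k)]

lemma genusCoeff_le (k g : ℕ) : genusCoeff k g ≤ 4 ^ k * (((k : ℝ) ^ 3) ^ g / g !) := by
  induction k using Nat.twoStepInduction generalizing g with
  | zero => cases g <;> simp [genusCoeff]
  | one => cases g <;> simp [genusCoeff]
  | more k ih₀ ih₁ =>
    cases g with
    | zero =>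
      have h := genusCoeff_zero_le k
      have := ih₁ 0
      simp only [pow_zero, Nat.factorial_zero, Nat.cast_one, div_one, mul_one, pow_succ] at this ⊢
      linarith
    | succ g =>
      push_cast [Nat.factorial_succ] at ih₁ ⊢
      calc genusCoeff (k + 2) (g + 1)
          ≤ 4 * genusCoeff (k + 1) (g + 1) + ((k : ℝ) + 1) ^ 2 * genusCoeff k g :=
            genusCoeff_succ_le k g
        _ ≤ 4 * (4 ^ (k + 1) * ((((k : ℝ) + 1) ^ 3) ^ (g + 1) / ((g + 1) * g !))) +
              16 * (((k : ℝ) + 1) ^ 2 * (4 ^ k * (((k : ℝ) ^ 3) ^ g / g !))) := by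
            refine add_le_add ?_ ?_
            · have := ih₁ (g + 1)
              push_cast [Nat.factorial_succ] at this
              gcongr
            · have := ih₀ g
              have : 0 ≤ 4 ^ k * (((k : ℝ) ^ 3) ^ g / g !) := by positivity
              calc ((k : ℝ) + 1) ^ 2 * genusCoeff k g
                  ≤ ((k : ℝ) + 1) ^ 2 * (16 * (4 ^ k * (((k : ℝ) ^ 3) ^ g / g !))) := by
                    gcongr
                    linarith
                _ = _ := by ring
        _ = 4 ^ (k + 2) * (((((k : ℝ) + 1) ^ 3) ^ (g + 1) +
              (g + 1) * (((k : ℝ) + 1) ^ 2 * ((k : ℝ) ^ 3) ^ g)) / ((g + 1) * g !)) := by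
            field_simp
            ring
        _ ≤ _ := by
            gcongr
            exact cube_pow_add_le k g

variable {N : ℕ}

lemma hasSum_genusCoeff_mul_pow (hN : 0 < N) (k : ℕ) :
    HasSum (fun g => genusCoeff k g * (((N : ℝ) ^ 2)⁻¹) ^ g) (normalizedMoment N k) := by
  set ε : ℝ := ((N : ℝ) ^ 2)⁻¹
  induction k using Nat.twoStepInduction with
  | zero =>
    rw [normalizedMoment_zero_right hN]
    convert hasSum_ite_eq 0 (1 : ℝ) with g
    cases g <;> simp [genusCoeff]
  | one =>
    rw [normalizedMoment_one_right hN]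
    convert hasSum_ite_eq 0 (1 : ℝ) with g
    cases g <;> simp [genusCoeff]
  | more k ih₀ ih₁ =>
    have moment := normalizedMoment_recurrence hN k
    have genus_zero := genusCoeff_recurrence_zero k
    rw [← hasSum_nat_add_iff' 1] at ih₁ ⊢
    have scaled := ((ih₁.mul_left (2 * (2 * (k : ℝ) + 3))).add
      (ih₀.mul_left (ε * (((k : ℝ) + 1) ^ 2 * k)))).div_const ((k : ℝ) + 3)
    have terms : (fun g => genusCoeff (k + 2) (g + 1) * ε ^ (g + 1)) = fun g =>
        (2 * (2 * k + 3) * (genusCoeff (k + 1) (g + 1) * ε ^ (g + 1)) +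
          ε * (((k : ℝ) + 1) ^ 2 * k) * (genusCoeff k g * ε ^ g)) / (k + 3) := by
      ext g
      rw [eq_div_iff (by positivity)]
      linear_combination ε ^ (g + 1) * genusCoeff_recurrence k g
    have total : normalizedMoment N (k + 2) -
          ∑ g ∈ Finset.range 1, genusCoeff (k + 2) g * ε ^ g =
        (2 * (2 * k + 3) * (normalizedMoment N (k + 1) -
            ∑ g ∈ Finset.range 1, genusCoeff (k + 1) g * ε ^ g) +
          ε * (((k : ℝ) + 1) ^ 2 * k) * normalizedMoment N k) / (k + 3) := by
      rw [Finset.sum_range_one, Finset.sum_range_one, eq_div_iff (by positivity)]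
      linear_combination moment - genus_zero
    rw [terms, total]
    exact scaled

lemma genusRemainder_nonneg (hN : 0 < N) (k j : ℕ) :
    0 ≤ normalizedMoment N k -
      ∑ g ∈ Finset.range j, genusCoeff k g * (((N : ℝ) ^ 2)⁻¹) ^ g :=
  sub_sum_nonneg_of_hasSum (hasSum_genusCoeff_mul_pow hN k)
    (fun g => mul_nonneg (genusCoeff_nonneg k g) (by positivity)) j

lemma genusRemainder_le (hN : 0 < N) (k j : ℕ) :
    normalizedMoment N k - ∑ g ∈ Finset.range j, genusCoeff k g * (((N : ℝ) ^ 2)⁻¹) ^ g ≤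
      4 ^ k * ((k ^ 3 * ((N : ℝ) ^ 2)⁻¹) ^ j * Real.exp (k ^ 3 * ((N : ℝ) ^ 2)⁻¹)) := by
  refine sub_sum_le_of_le_pow_div_factorial (hasSum_genusCoeff_mul_pow hN k) (by positivity)
    (by positivity) (fun g => ?_) j
  rw [mul_pow, mul_div_right_comm, ← mul_assoc]
  gcongr
  exact genusCoeff_le k g

end GenusCoefficients

section GenusExpansion

open Filter Asymptotics

/-- The order at which the moment series is cut off at matrix size `N`. It is of order `√N`, so that
the discarded geometric tails are smaller than every power of `N⁻¹`, while `k³ / N²`, which governs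
the genus expansion of the `k`-th moment, is bounded over the moments kept. -/
def truncation (N : ℕ) : ℕ :=
  N.sqrt + 1

variable {N : ℕ} {x : ℂ}

lemma cast_le_truncation_sq (N : ℕ) : (N : ℝ) ≤ (truncation N : ℝ) ^ 2 := by
  have : N < (truncation N) ^ 2 := Nat.lt_succ_sqrt' N
  exact_mod_cast this.le

lemma truncation_cube_mul_inv_sq_le (hN : 0 < N) :
    (truncation N : ℝ) ^ 3 * ((N : ℝ) ^ 2)⁻¹ ≤ 8 := by
  have sqrt_pos : 1 ≤ N.sqrt := Nat.sqrt_pos.2 hN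
  have cube_le : truncation N ^ 3 ≤ 8 * N ^ 2 :=
    calc (N.sqrt + 1) ^ 3 ≤ (2 * N.sqrt) ^ 3 := by gcongr; omega
      _ = 8 * (N.sqrt * N.sqrt ^ 2) := by ring
      _ ≤ 8 * (N * N) := by
        gcongr
        exacts [Nat.sqrt_le_self N, Nat.sqrt_le' N]
      _ = 8 * N ^ 2 := by ring
  rw [← div_eq_mul_inv, div_le_iff₀ (by positivity)]
  exact_mod_cast cube_le

lemma isBigO_of_truncation_pow_mul_norm_le {f : ℕ → ℂ} {B : ℝ} {j : ℕ}
    (h : ∀ N, 0 < N → (truncation N : ℝ) ^ (4 * j) * ‖f N‖ ≤ B) :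
    f =O[atTop] fun N : ℕ => (((N : ℝ) ^ 2)⁻¹) ^ j := by
  refine .of_bound B ((eventually_gt_atTop 0).mono fun N hN => ?_)
  have pow_le : ((N : ℝ) ^ 2) ^ j ≤ (truncation N : ℝ) ^ (4 * j) := by
    rw [pow_mul, show (4 : ℕ) = 2 * 2 from rfl, pow_mul]
    gcongr
    exact cast_le_truncation_sq N
  rw [Real.norm_of_nonneg (by positivity), inv_pow, ← div_eq_mul_inv, le_div_iff₀ (by positivity),
    mul_comm]
  exact (mul_le_mul_of_nonneg_right pow_le (norm_nonneg _)).trans (h N hN)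

lemma norm_mul_inv_pow_succ_le {r A : ℝ} {k : ℕ} (hx : 1 ≤ ‖x‖) (hr₀ : 0 ≤ r)
    (hr : r ≤ 4 ^ k * A) : ‖(r : ℂ) * (x ^ (k + 1))⁻¹‖ ≤ A * (4 / ‖x‖) ^ k := by
  rw [norm_mul, norm_inv, norm_pow, Complex.norm_of_nonneg hr₀, div_pow, mul_div_assoc',
    mul_comm A, ← div_eq_mul_inv]
  gcongr
  · exact hr₀.trans hr
  · exact k.le_succ

lemma summable_pow_mul_four_div_pow (hx : 4 < ‖x‖) (J : ℕ) :
    Summable fun k : ℕ => (k : ℝ) ^ J * (4 / ‖x‖) ^ k := by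
  refine summable_pow_mul_geometric_of_norm_lt_one J ?_
  rw [Real.norm_of_nonneg (by positivity), div_lt_one (by linarith)]
  exact hx

/-- The candidate for the genus `g` term `W₁^{(g)}` of the expansion of `oneLoopMean`. -/
def genusTerm (g : ℕ) (x : ℂ) : ℂ :=
  ∑' k : ℕ, (genusCoeff k g : ℂ) * (x ^ (k + 1))⁻¹

lemma summable_pow_mul_norm_genusCoeff_mul (hx : 4 < ‖x‖) (g J : ℕ) :
    Summable fun k : ℕ => (k : ℝ) ^ J * ‖(genusCoeff k g : ℂ) * (x ^ (k + 1))⁻¹‖ := by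
  refine .of_nonneg_of_le (fun k => by positivity) (fun k => ?_)
    (summable_pow_mul_four_div_pow hx (J + 3 * g))
  rw [pow_add (k : ℝ), mul_assoc, pow_mul]
  gcongr
  refine norm_mul_inv_pow_succ_le (by linarith) (genusCoeff_nonneg k g)
    ((genusCoeff_le k g).trans ?_)
  gcongr
  exact div_le_self (by positivity) (mod_cast g.factorial_pos)

lemma hasSum_genusTerm (hx : 4 < ‖x‖) (g : ℕ) :
    HasSum (fun k : ℕ => (genusCoeff k g : ℂ) * (x ^ (k + 1))⁻¹) (genusTerm g x) :=
  (summable_of_summable_pow_mul_norm (summable_pow_mul_norm_genusCoeff_mul hx g 0)).hasSum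

lemma isBigO_inv_pow_mul_genusTerm_sub_sum (hx : 4 < ‖x‖) (g j : ℕ) :
    (fun N : ℕ => (((N : ℂ) ^ 2)⁻¹) ^ g * (genusTerm g x -
        ∑ k ∈ Finset.range (truncation N), (genusCoeff k g : ℂ) * (x ^ (k + 1))⁻¹))
      =O[atTop] fun N : ℕ => (((N : ℝ) ^ 2)⁻¹) ^ j := by
  refine isBigO_of_truncation_pow_mul_norm_le (B :=
    ∑' k : ℕ, (k : ℝ) ^ (4 * j) * ‖(genusCoeff k g : ℂ) * (x ^ (k + 1))⁻¹‖) fun N hN => ?_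
  refine le_trans ?_ (pow_mul_norm_tsum_sub_sum_le
    (summable_pow_mul_norm_genusCoeff_mul hx g (4 * j)) (truncation N))
  have one_le : (1 : ℝ) ≤ N := mod_cast hN
  have le_one : ‖(((N : ℂ) ^ 2)⁻¹) ^ g‖ ≤ 1 := by
    rw [norm_pow, norm_inv, norm_pow, Complex.norm_natCast]
    exact pow_le_one₀ (by positivity) (inv_le_one_of_one_le₀ (one_le_pow₀ one_le))
  rw [norm_mul]
  gcongr
  exact mul_le_of_le_one_left (norm_nonneg _) le_one

lemma normalizedMoment_truncation_le (hN : 0 < N) :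
    normalizedMoment N (truncation N) ≤ 4 ^ truncation N * Real.exp 8 := by
  have h := genusRemainder_le hN (truncation N) 0
  rw [Finset.sum_range_zero, sub_zero, pow_zero, one_mul] at h
  exact h.trans (by gcongr; exact truncation_cube_mul_inv_sq_le hN)

lemma isBigO_oneLoopMean_sub_sum {δ : ℝ} (hδ : 0 < δ)
    (hdist : ∀ t : ℝ, 0 ≤ t → δ ≤ ‖x - t‖) (hx : 4 < ‖x‖) (j : ℕ) :
    (fun N : ℕ => (N : ℂ)⁻¹ * oneLoopMean N x - ∑ k ∈ Finset.range (truncation N),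
        (normalizedMoment N k : ℂ) * (x ^ (k + 1))⁻¹)
      =O[atTop] fun N : ℕ => (((N : ℝ) ^ 2)⁻¹) ^ j := by
  obtain ⟨M, hM⟩ :=
    (summable_pow_mul_four_div_pow hx (4 * j)).tendsto_atTop_zero.bddAbove_range
  refine isBigO_of_truncation_pow_mul_norm_le (B := δ⁻¹ * Real.exp 8 * M) fun N hN => ?_
  set K := truncation N
  have hN' : (N : ℂ) ≠ 0 := mod_cast hN.ne'
  have remainder : ‖(N : ℂ)⁻¹ * oneLoopMean N x -
      ∑ k ∈ Finset.range K, (normalizedMoment N k : ℂ) * (x ^ (k + 1))⁻¹‖ ≤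
        δ⁻¹ * Real.exp 8 * (4 / ‖x‖) ^ K :=
    calc _ = (N : ℝ)⁻¹ * ‖oneLoopMean N x -
            N * ∑ k ∈ Finset.range K, (normalizedMoment N k : ℂ) * (x ^ (k + 1))⁻¹‖ := by
          rw [← Complex.norm_natCast, ← norm_inv, ← norm_mul, mul_sub,
            inv_mul_cancel_left₀ hN']
      _ ≤ (N : ℝ)⁻¹ * ((‖x‖ ^ K)⁻¹ * (δ⁻¹ * (N * (4 ^ K * Real.exp 8)))) := by
          gcongr
          refine (norm_oneLoopMean_sub_sum_le hN hδ hdist K).trans ?_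
          gcongr
          exact normalizedMoment_truncation_le hN
      _ = δ⁻¹ * Real.exp 8 * (4 / ‖x‖) ^ K := by
          rw [div_pow]
          field_simp
  calc (K : ℝ) ^ (4 * j) * _ ≤ (K : ℝ) ^ (4 * j) * (δ⁻¹ * Real.exp 8 * (4 / ‖x‖) ^ K) := by
        gcongr
    _ = δ⁻¹ * Real.exp 8 * ((K : ℝ) ^ (4 * j) * (4 / ‖x‖) ^ K) := by ring
    _ ≤ δ⁻¹ * Real.exp 8 * M := by
        gcongr
        exact hM ⟨K, rfl⟩

lemma isBigO_sum_genusRemainder_mul (hx : 4 < ‖x‖) (j : ℕ) :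
    (fun N : ℕ => ∑ k ∈ Finset.range (truncation N), ((normalizedMoment N k -
        ∑ g ∈ Finset.range j, genusCoeff k g * (((N : ℝ) ^ 2)⁻¹) ^ g : ℝ) : ℂ) * (x ^ (k + 1))⁻¹)
      =O[atTop] fun N : ℕ => (((N : ℝ) ^ 2)⁻¹) ^ j := by
  have summable := summable_pow_mul_four_div_pow hx (3 * j)
  refine .of_bound (Real.exp 8 * ∑' k : ℕ, (k : ℝ) ^ (3 * j) * (4 / ‖x‖) ^ k)
    ((eventually_gt_atTop 0).mono fun N hN => ?_)
  set ε : ℝ := ((N : ℝ) ^ 2)⁻¹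
  have term_le : ∀ k ∈ Finset.range (truncation N), ‖((normalizedMoment N k -
      ∑ g ∈ Finset.range j, genusCoeff k g * ε ^ g : ℝ) : ℂ) * (x ^ (k + 1))⁻¹‖ ≤
        Real.exp 8 * ε ^ j * ((k : ℝ) ^ (3 * j) * (4 / ‖x‖) ^ k) := fun k hk => by
    have exponent_le : (k : ℝ) ^ 3 * ε ≤ 8 := by
      refine le_trans ?_ (truncation_cube_mul_inv_sq_le hN)
      gcongr
      exact (Finset.mem_range.1 hk).le
    refine (norm_mul_inv_pow_succ_le (by linarith) (genusRemainder_nonneg hN k j)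
      ((genusRemainder_le hN k j).trans (mul_le_mul_of_nonneg_left (mul_le_mul_of_nonneg_left
        (Real.exp_le_exp.2 exponent_le) (by positivity)) (by positivity)))).trans_eq ?_
    rw [mul_pow, ← pow_mul]
    ring
  calc _ ≤ ∑ k ∈ Finset.range (truncation N),
            Real.exp 8 * ε ^ j * ((k : ℝ) ^ (3 * j) * (4 / ‖x‖) ^ k) :=
        norm_sum_le_of_le _ term_le
    _ ≤ Real.exp 8 * ε ^ j * ∑' k : ℕ, (k : ℝ) ^ (3 * j) * (4 / ‖x‖) ^ k := by
        rw [← Finset.mul_sum]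
        gcongr
        exact summable.sum_le_tsum _ fun k _ => by positivity
    _ = _ := by
        rw [Real.norm_of_nonneg (by positivity)]
        ring

/-- The interchange of the two sums over `k < truncation N` and `g < j` splits the error of the
genus expansion into the error of the moment expansion, the genus remainders of the moments, and
the tails of the series `genusTerm g x`. -/
lemma isBigO_inv_mul_oneLoopMean_sub_sum_genusTerm {δ : ℝ} (hδ : 0 < δ)
    (hdist : ∀ t : ℝ, 0 ≤ t → δ ≤ ‖x - t‖) (hx : 4 < ‖x‖) (j : ℕ) :
    (fun N : ℕ => (N : ℂ)⁻¹ * oneLoopMean N x -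
        ∑ g ∈ Finset.range j, (((N : ℂ) ^ 2)⁻¹) ^ g * genusTerm g x)
      =O[atTop] fun N : ℕ => (((N : ℝ) ^ 2)⁻¹) ^ j := by
  refine (((isBigO_oneLoopMean_sub_sum hδ hdist hx j).add
    (isBigO_sum_genusRemainder_mul hx j)).sub (IsBigO.fun_sum fun g (_ : g ∈ Finset.range j) =>
      isBigO_inv_pow_mul_genusTerm_sub_sum hx g j)).congr_left fun N => ?_
  push_cast
  simp only [mul_sub, sub_mul, Finset.sum_sub_distrib, Finset.mul_sum, Finset.sum_mul]
  rw [Finset.sum_comm (s := Finset.range j)]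
  simp only [mul_left_comm, mul_assoc]
  ring

lemma exists_dist_pos_of_mem_cutNhd {R : ℝ} (hx : x ∈ cutNhd R) :
    ∃ δ : ℝ, 0 < δ ∧ ∀ t : ℝ, 0 ≤ t → δ ≤ ‖x - t‖ := by
  have half_line_closed : IsClosed ((fun t : ℝ => (t : ℂ)) '' Set.Ici 0) :=
    Complex.isometry_ofReal.isClosedEmbedding.isClosedMap _ isClosed_Ici
  have notMem : x ∉ (fun t : ℝ => (t : ℂ)) '' Set.Ici 0 := by
    rintro ⟨t, ht, rfl⟩
    exact hx.2 t ht rfl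
  refine ⟨_, (half_line_closed.notMem_iff_infDist_pos ⟨_, 0, Set.self_mem_Ici, rfl⟩).1 notMem,
    fun t ht => ?_⟩
  rw [← dist_eq_norm]
  exact Metric.infDist_le_dist_of_mem ⟨t, ht, rfl⟩

theorem isGenusExpansion_genusTerm : IsGenusExpansion 4 genusTerm := by
  intro x hx G
  obtain ⟨δ, hδ, hdist⟩ := exists_dist_pos_of_mem_cutNhd hx
  have expansion := (isBigO_refl (fun N : ℕ => (N : ℝ)) atTop).smul
    (isBigO_inv_mul_oneLoopMean_sub_sum_genusTerm hδ hdist hx.1 (G + 1))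
  refine expansion.congr' ((eventually_gt_atTop 0).mono fun N hN => ?_) (.of_forall fun N => ?_)
  · have hN' : (N : ℂ) ≠ 0 := mod_cast hN.ne'
    simp only [Complex.real_smul, Complex.ofReal_natCast, mul_sub, mul_inv_cancel_left₀ hN',
      Finset.mul_sum, zpow_one_sub_two_mul, mul_assoc]
  · simp only [smul_eq_mul]
    rw [← zpow_one_sub_two_mul]
    congr 1
    push_cast
    ring

end GenusExpansion

section LaurentCoefficients

/-- The coefficient of `x ^ (-1 - 2 * g - n)` in `genusTerm g x`, written `C_n^{(g)}` in the
statement of the theorem. -/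
def laurentCoeff (g n : ℕ) : ℝ :=
  genusCoeff (n + 2 * g) g

theorem isCoefficients_genusTerm :
    IsCoefficients 4 genusTerm fun g n => (laurentCoeff g n : ℂ) := by
  intro g x hx
  have low_order : ∑ k ∈ Finset.range (2 * g), (genusCoeff k g : ℂ) * (x ^ (k + 1))⁻¹ = 0 :=
    Finset.sum_eq_zero fun k hk => by
      have := Finset.mem_range.1 hk
      rw [genusCoeff_eq_zero (by omega) (by omega), Complex.ofReal_zero, zero_mul]
  have shifted := (hasSum_nat_add_iff' (2 * g)).2 (hasSum_genusTerm hx.1 g)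
  rw [low_order, sub_zero] at shifted
  refine shifted.congr_fun fun n => ?_
  simp only [laurentCoeff]
  rw [← zpow_natCast, ← zpow_neg]
  congr 2
  push_cast
  ring

lemma laurentCoeff_recurrence (g n : ℕ) :
    ((n : ℝ) + 2 * g + 4) * laurentCoeff (g + 1) (n + 1) =
      ((n : ℝ) + 2 * g + 1) * ((n : ℝ) + 2 * g + 2) ^ 2 * laurentCoeff g (n + 1) +
        2 * (2 * n + 4 * g + 5) * laurentCoeff (g + 1) n := by
  have h := genusCoeff_recurrence (n + 1 + 2 * g) g
  simp only [laurentCoeff]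
  rw [show n + 1 + 2 * (g + 1) = n + 1 + 2 * g + 2 by ring,
    show n + 2 * (g + 1) = n + 1 + 2 * g + 1 by ring]
  push_cast at h
  linear_combination h

lemma laurentCoeff_zero_zero : laurentCoeff 0 0 = 1 := by
  simp [laurentCoeff, genusCoeff]

lemma laurentCoeff_zero_right {g : ℕ} (hg : 0 < g) : laurentCoeff g 0 = 0 :=
  genusCoeff_eq_zero (by omega) hg

lemma laurentCoeff_one_right (g : ℕ) :
    laurentCoeff g 1 = 2 ^ g * g ! * (2 * g - 1)‼ / ((g : ℝ) + 1) := by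
  induction g with
  | zero => simp [laurentCoeff, genusCoeff]
  | succ g ih =>
    have recurrence := laurentCoeff_recurrence g 0
    rw [laurentCoeff_zero_right g.succ_pos, ih, Nat.cast_zero] at recurrence
    have doubleFactorial : (2 * (g + 1) - 1)‼ = (2 * g + 1) * (2 * g - 1)‼ := by
      cases g with
      | zero => rfl
      | succ g => exact Nat.doubleFactorial_add_two (2 * g + 1)
    refine mul_left_cancel₀ (by positivity : 0 + 2 * (g : ℝ) + 4 ≠ 0) (recurrence.trans ?_)
    rw [doubleFactorial, Nat.factorial_succ]
    push_cast
    field_simp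
    ring

end LaurentCoefficients

section Uniqueness

open Filter Topology Asymptotics

variable {R : ℝ} {W W' : ℕ → ℂ → ℂ} {C C' : ℕ → ℕ → ℂ}

lemma cutNhd_anti {R' : ℝ} (h : R ≤ R') : cutNhd R' ⊆ cutNhd R :=
  fun _ hx => ⟨h.trans_lt hx.1, hx.2⟩

lemma IsGenusExpansion.unique (hW : IsGenusExpansion R W) (hW' : IsGenusExpansion R W') (g : ℕ)
    {x : ℂ} (hx : x ∈ cutNhd R) : W g x = W' g x := by
  have scale (g : ℕ) : (fun N : ℕ => (N : ℂ) ^ (1 - 2 * ((g + 1 : ℕ) : ℤ))) =o[atTop]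
      fun N : ℕ => (N : ℂ) ^ (1 - 2 * (g : ℤ)) := by
    have inv_sq_tendsto : Tendsto (fun N : ℕ => ((N : ℂ) ^ 2)⁻¹) atTop (𝓝 0) := by
      simpa using (tendsto_inv_atTop_nhds_zero_nat (𝕜 := ℂ)).pow 2
    refine (((isLittleO_one_iff ℂ).2 inv_sq_tendsto).mul_isBigO (isBigO_refl _ _)).congr
      (fun N => ?_) fun N => one_mul _
    rw [zpow_one_sub_two_mul, zpow_one_sub_two_mul]
    ring
  have scale_ne_zero (g : ℕ) : ∃ᶠ N : ℕ in atTop, (N : ℂ) ^ (1 - 2 * (g : ℤ)) ≠ 0 :=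
    ((eventually_gt_atTop 0).mono fun N hN => zpow_ne_zero _ (mod_cast hN.ne')).frequently
  have remainder (G N : ℕ) :
      ‖(N : ℝ) ^ (-1 - 2 * (G : ℤ))‖ = ‖(N : ℂ) ^ (1 - 2 * ((G + 1 : ℕ) : ℤ))‖ := by
    rw [norm_zpow, norm_zpow, Complex.norm_natCast, Real.norm_natCast]
    congr 1
    push_cast
    ring
  exact congrFun (eq_of_isBigO_sub_sum_asymptoticScale scale scale_ne_zero
    (fun G => (hW x hx G).trans (isBigO_of_le _ fun N => (remainder G N).le))
    fun G => (hW' x hx G).trans (isBigO_of_le _ fun N => (remainder G N).le)) g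

lemma frequently_inv_mem_cutNhd (R : ℝ) : ∃ᶠ z in 𝓝[≠] (0 : ℂ), z⁻¹ ∈ cutNhd R := by
  have negative_axis : Tendsto (fun t : ℝ => -(t : ℂ)) (𝓝[>] 0) (𝓝[≠] 0) := by
    refine tendsto_nhdsWithin_of_tendsto_nhds_of_eventually_within _ ?_ ?_
    · have : Continuous fun t : ℝ => -(t : ℂ) := by fun_prop
      simpa using (this.tendsto 0).mono_left nhdsWithin_le_nhds
    · filter_upwards [self_mem_nhdsWithin] with t ht
      simpa using (ne_of_gt ht : t ≠ 0)
  refine negative_axis.frequently (Eventually.frequently ?_)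
  filter_upwards [self_mem_nhdsWithin, tendsto_inv_nhdsGT_zero.eventually_gt_atTop R]
    with t (ht : 0 < t) hR
  refine ⟨?_, fun s hs h => ?_⟩
  · rwa [norm_inv, norm_neg, Complex.norm_real, Real.norm_of_nonneg ht.le]
  · have : (-t)⁻¹ = s := mod_cast h
    linarith [inv_lt_zero.2 (neg_lt_zero.2 ht)]

lemma IsCoefficients.unique (hC : IsCoefficients R W C) (hC' : IsCoefficients R W C') (g n : ℕ) :
    C g n = C' g n := by
  suffices h : (fun n => C g n - C' g n) = 0 from sub_eq_zero.1 (congrFun h n)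
  refine eq_zero_of_frequently_hasSum_zero
    (((frequently_inv_mem_cutNhd R).and_eventually self_mem_nhdsWithin).mono ?_)
  rintro z ⟨hz, hz₀ : z ≠ 0⟩
  have difference := ((hC g _ hz).sub (hC' g _ hz)).mul_left (z⁻¹ ^ (1 + 2 * (g : ℤ)))
  rw [sub_self, mul_zero] at difference
  refine difference.congr_fun fun n => ?_
  have monomial_eq : z⁻¹ ^ (1 + 2 * (g : ℤ)) * z⁻¹ ^ (-1 - 2 * (g : ℤ) - (n : ℤ)) = z ^ n := by
    rw [← zpow_add₀ (inv_ne_zero hz₀), ← zpow_natCast, inv_zpow']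
    congr 1
    ring
  linear_combination (C' g n - C g n) * monomial_eq

theorem IsGenusExpansion.coefficients_eq (hW : IsGenusExpansion R W) (hC : IsCoefficients R W C)
    (g n : ℕ) : C g n = laurentCoeff g n := by
  have terms_eq {g : ℕ} {x : ℂ} (hx : x ∈ cutNhd (max R 4)) : genusTerm g x = W g x :=
    IsGenusExpansion.unique (R := max R 4)
      (fun x hx => isGenusExpansion_genusTerm x (cutNhd_anti (le_max_right R 4) hx))
      (fun x hx => hW x (cutNhd_anti (le_max_left R 4) hx)) g hx
  refine IsCoefficients.unique (R := max R 4) (W := W) (C' := fun g n => laurentCoeff g n)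
    (fun g x hx => hC g x (cutNhd_anti (le_max_left R 4) hx)) (fun g x hx => ?_) g n
  rw [← terms_eq hx]
  exact isCoefficients_genusTerm g x (cutNhd_anti (le_max_right R 4) hx)

end Uniqueness

end Laguerre

end

theorem mainTheorem1 :
    (∃ (W : ℕ → ℂ → ℂ) (C : ℕ → ℕ → ℂ),
      Laguerre.IsGenusExpansion 4 W ∧ Laguerre.IsCoefficients 4 W C) ∧
    ∀ (R : ℝ) (W : ℕ → ℂ → ℂ) (C : ℕ → ℕ → ℂ),
      Laguerre.IsGenusExpansion R W → Laguerre.IsCoefficients R W C →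
        (∀ n g : ℕ, 0 < n → 0 < g →
          ((n : ℂ) + 2 * g + 1) * C g n =
            ((n : ℂ) + 2 * g - 2) * ((n : ℂ) + 2 * g - 1) ^ 2 * C (g - 1) n +
              2 * (2 * (n : ℂ) + 4 * g - 1) * C g (n - 1)) ∧
        C 0 0 = 1 ∧
        (∀ g : ℕ, 1 ≤ g → C g 0 = 0) ∧
        (∀ g : ℕ, C g 1 = (2 : ℂ) ^ g * (g ! : ℂ) * ((2 * g - 1)‼ : ℂ) / ((g : ℂ) + 1)) := by
  refine ⟨⟨_, _, Laguerre.isGenusExpansion_genusTerm, Laguerre.isCoefficients_genusTerm⟩,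
    fun R W C hW hC => ?_⟩
  have coefficients_eq := hW.coefficients_eq hC
  refine ⟨fun n g hn hg => ?_, ?_, fun g hg => ?_, fun g => ?_⟩
  · obtain ⟨n, rfl⟩ := Nat.exists_eq_succ_of_ne_zero hn.ne'
    obtain ⟨g, rfl⟩ := Nat.exists_eq_succ_of_ne_zero hg.ne'
    have recurrence := congrArg ((↑) : ℝ → ℂ) (Laguerre.laurentCoeff_recurrence g n)
    simp only [coefficients_eq, Nat.succ_sub_one]
    push_cast at recurrence ⊢
    linear_combination recurrence
  · rw [coefficients_eq, Laguerre.laurentCoeff_zero_zero, Complex.ofReal_one]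
  · rw [coefficients_eq, Laguerre.laurentCoeff_zero_right hg, Complex.ofReal_zero]
  · rw [coefficients_eq, Laguerre.laurentCoeff_one_right]
    push_cast
    rfl
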